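/- Let $f(x)\in\mathbb Z[x]$ be a monic polynomial of degree $n$ with complex roots $\alpha_1,\dots,\alpha_n$ (listed with multiplicity, in a fixed order). Put $$LR=\{(l_1,\dots,l_{n+1})\in\mathbb Q^{n+1}: \textstyle\sum_{i=1}^n l_i\alpha_i=l_{n+1}\},\qquad t=\dim_{\mathbb Q}LR\ (\le n),$$ $$LR_0=\{(l_1,\dots,l_n)\in\mathbb Q^{n}: \textstyle\sum_{i=1}^n l_i\alpha_i\in\mathbb Q\}.$$ Let $\hat m_j=(m_{j,1},\dots,m_{j,n},m_j)$ $(1\le j\le t)$ be a $\mathbb Z$-basis of $LR\cap\mathbb Z^{n+1}$ and $\boldsymbol m_j=(m_{j,1},\dots,m_{j,n})$. For $\sigma\in S_n$ let $\sigma(x_1,\dots,x_n)=(x_{\sigma^{-1}(1)},\dots,x_{\sigma^{-1}(n)})$, let $\sigma(\boldsymbol x,x)=(\sigma(\boldsymbol x),x)$ on $\mathbb Q^{n+1}$, and put $$\hat G=\{\sigma\in S_n:\langle\sigma(\hat m_1),\dots,\sigma(\hat m_t)\rangle_{\mathbb Z}=\langle\hat m_1,\dots,\hat m_t\rangle_{\mathbb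 Z}\},\qquad G=\{\sigma\in S_n:\langle\sigma(\boldsymbol m_1),\dots,\sigma(\boldsymbol m_t)\rangle_{\mathbb Z}=\langle\boldsymbol m_1,\dots,\boldsymbol m_t\rangle_{\mathbb Z}\}.$$ Let $$\mathfrak D(f,\sigma)=\Bigl\{x\in[0,1]^n: x_1\le\dots\le x_n,\ \textstyle\sum_{i} m_{j,i}x_{\sigma(i)}\in\mathbb Z\ (1\le j\le t)\Bigr\},$$ $$\mathfrak D_f=\{x\in\mathbb R^n: (x,l)\in\mathbb Z\text{ for all }l\in LR_0\cap\mathbb Z^n\},$$ where $(\cdot,\cdot)$ is the standard inner product on $\mathbb R^n$, and let $\mathrm{vol}$ denote $(n-t)$-dimensional volume in $\mathbb R^n$ (Hausdorff measure normalized so as to agree with Lebesgue measure in orthonormal coordinates on $(n-t)$-dimensional affine subspaces). For a prime $p$ for which $f$ is a product of linear factors modulo $p$, let $r_1,\dots,r_n$ be its local roots, i.e. the integers with $f(x)\equiv\prod_i(x-r_i)\bmod p$ and $0\le r_1\le\dots\le r_n<p$. Let $Spl_X(f)$ be the set of all such primes $p\le X$, let $Spl_X(f,\sigma)$ be the set of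 those $p\in Spl_X(f)$ with $\sum_i m_{j,i}r_{\sigma(i)}\equiv m_j\bmod p$ for $1\le j\le t$, and let $$Pr(f,\sigma)=\lim_{X\to\infty}\#Spl_X(f,\sigma)/\#Spl_X(f).$$ **Proposition.** Suppose that $f$ is not a product of linear forms over $\mathbb Q$ and that $\alpha_i-\alpha_j\notin\mathbb Q$ for all $i\ne j$. Then $$\#G\cdot \mathrm{vol}\Bigl(\bigcup_{\sigma\in S_n}\mathfrak D(f,\sigma)\Bigr)=\sum_{\sigma\in S_n}\mathrm{vol}(\mathfrak D(f,\sigma)),\qquad \mathrm{vol}([0,1)^n\cap\mathfrak D_f)=\sqrt{\det((\boldsymbol m_i,\boldsymbol m_j))_{1\le i,j\le t}} .$$ If moreover $f$ has no rational root, then also $$\sum_{\sigma\in S_n}\mathrm{vol}(\mathfrak D(f,\sigma))=\mathrm{vol}([0,1)^n\cap\mathfrak D_f),$$ so that all four numbers are equal. Consequently, in this last case, if the limits $Pr(f,\sigma)$ exist and $\mathrm{vol}(\mathfrak D(f,\sigma))=c\cdot Pr(f,\sigma)$ for all $\sigma\in S_n$ with a real constant $c$, then $$c=\sqrt{\det((\boldsymbol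 m_i,\boldsymbol m_j))}\,/\,\#\hat G .$$ -/

import Mathlib

open scoped MeasureTheory

noncomputable section

namespace RootRelations

variable {n t : ℕ}

/-- The rational vector space `LR` of all `(l₁, …, lₙ, lₙ₊₁) ∈ ℚⁿ⁺¹` with
`∑ i, lᵢ αᵢ = lₙ₊₁`; the space `ℚⁿ⁺¹` is written as `ℚⁿ × ℚ`. -/
def LR (α : Fin n → ℂ) : Submodule ℚ ((Fin n → ℚ) × ℚ) where
  carrier := {l | ∑ i, (l.1 i : ℂ) * α i = (l.2 : ℂ)}
  add_mem' := by
    intro a b ha hb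
    simp only [Set.mem_ofPred_eq] at ha hb ⊢
    simp [add_mul, Finset.sum_add_distrib, ha, hb]
  zero_mem' := by simp
  smul_mem' := by
    intro c a ha
    simp only [Set.mem_ofPred_eq] at ha ⊢
    simp [mul_assoc, ← Finset.mul_sum, ha]

/-- The rational vector space `LR₀` of all `l ∈ ℚⁿ` such that `∑ i, lᵢ αᵢ` is rational. -/
def LR₀ (α : Fin n → ℂ) : Submodule ℚ (Fin n → ℚ) where
  carrier := {l | ∃ q : ℚ, ∑ i, (l i : ℂ) * α i = (q : ℂ)}
  add_mem' := by
    rintro a b ⟨p, hp⟩ ⟨q, hq⟩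
    exact ⟨p + q, by simp [add_mul, Finset.sum_add_distrib, hp, hq]⟩
  zero_mem' := ⟨0, by simp⟩
  smul_mem' := by
    rintro c a ⟨p, hp⟩
    exact ⟨c * p, by simp [mul_assoc, ← Finset.mul_sum, hp]⟩

/-- The number `t = dim_ℚ LR`. -/
def relDim (α : Fin n → ℂ) : ℕ := Module.finrank ℚ (LR α)

/-- The lattice `LR ∩ ℤⁿ⁺¹`. -/
def intLR (α : Fin n → ℂ) : Submodule ℤ ((Fin n → ℤ) × ℤ) where
  carrier := {l | ((fun i => (l.1 i : ℚ)), (l.2 : ℚ)) ∈ LR α}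
  add_mem' := by
    intro a b ha hb
    have h := (LR α).add_mem ha hb
    simp only [Set.mem_ofPred_eq]
    convert h using 1
    ext <;> simp
  zero_mem' := by
    have h := (LR α).zero_mem
    simp only [Set.mem_ofPred_eq]
    convert h using 1
    ext <;> simp
  smul_mem' := by
    intro c a ha
    have h := (LR α).smul_mem (c : ℚ) ha
    simp only [Set.mem_ofPred_eq]
    convert h using 1
    ext <;> simp

/-- The vectors `m̂ⱼ = (m_{j,1}, …, m_{j,n}, mⱼ)` form a `ℤ`-basis of `LR ∩ ℤⁿ⁺¹`. The first
component of the pair `m̂ⱼ` is the vector `(m_{j,1}, …, m_{j,n})`. -/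
structure IsRelBasis (α : Fin n → ℂ) (mhat : Fin t → (Fin n → ℤ) × ℤ) : Prop where
  linearIndependent : LinearIndependent ℤ mhat
  span_eq : Submodule.span ℤ (Set.range mhat) = intLR α

/-- The action of permutations on vectors, `σ(x) = (x_{σ⁻¹(1)}, …, x_{σ⁻¹(n)})`. -/
def permVec (σ : Equiv.Perm (Fin n)) (x : Fin n → ℤ) : Fin n → ℤ := fun i => x (σ⁻¹ i)

/-- The group `Ĝ` of all `σ` with `⟨σ(m̂₁), …, σ(m̂ₜ)⟩_ℤ = ⟨m̂₁, …, m̂ₜ⟩_ℤ`, where `σ` fixes the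
last coordinate. -/
def groupGhat (mhat : Fin t → (Fin n → ℤ) × ℤ) : Set (Equiv.Perm (Fin n)) :=
  {σ | Submodule.span ℤ (Set.range fun j => (permVec σ (mhat j).1, (mhat j).2))
    = Submodule.span ℤ (Set.range mhat)}

/-- The group `G` of all `σ` with `⟨σ(m₁), …, σ(mₜ)⟩_ℤ = ⟨m₁, …, mₜ⟩_ℤ`. -/
def groupG (mhat : Fin t → (Fin n → ℤ) × ℤ) : Set (Equiv.Perm (Fin n)) :=
  {σ | Submodule.span ℤ (Set.range fun j => permVec σ (mhat j).1)
    = Submodule.span ℤ (Set.range fun j => (mhat j).1)}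

/-- The number `√(det ((mᵢ, mⱼ))_{1 ≤ i, j ≤ t})`. -/
def sqrtGram (mhat : Fin t → (Fin n → ℤ) × ℤ) : ℝ :=
  Real.sqrt (Matrix.of fun i j : Fin t =>
    ∑ k, ((mhat i).1 k : ℝ) * ((mhat j).1 k : ℝ)).det

/-- The set `𝔇(f, σ)` of all `x ∈ [0,1]ⁿ` with `x₁ ≤ ⋯ ≤ xₙ` and `∑ i, m_{j,i} x_{σ(i)} ∈ ℤ` for
all `j`. -/
def sortedDomain (mhat : Fin t → (Fin n → ℤ) × ℤ) (σ : Equiv.Perm (Fin n)) :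
    Set (EuclideanSpace ℝ (Fin n)) :=
  {x | (∀ i, x i ∈ Set.Icc (0 : ℝ) 1) ∧ (∀ i j, i ≤ j → x i ≤ x j) ∧
    ∀ j, ∃ k : ℤ, ∑ i, ((mhat j).1 i : ℝ) * x (σ i) = k}

/-- The set `𝔇_f` of all `x ∈ ℝⁿ` with `(x, l) ∈ ℤ` for all `l ∈ LR₀ ∩ ℤⁿ`. -/
def fullDomain (α : Fin n → ℂ) : Set (EuclideanSpace ℝ (Fin n)) :=
  {x | ∀ l : Fin n → ℤ, (fun i => (l i : ℚ)) ∈ LR₀ α → ∃ k : ℤ, ∑ i, x i * (l i : ℝ) = k}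

/-- The half-open cube `[0,1)ⁿ`. -/
def unitCube (n : ℕ) : Set (EuclideanSpace ℝ (Fin n)) :=
  {x | ∀ i, x i ∈ Set.Ico (0 : ℝ) 1}

/-- The `(n - t)`-dimensional volume on `ℝⁿ`, with `t = dim LR ≤ n`. It is the Hausdorff measure
normalized to be Lebesgue measure, in orthonormal coordinates, on every `(n - t)`-dimensional
affine subspace. -/
def vol (α : Fin n → ℂ) (S : Set (EuclideanSpace ℝ (Fin n))) : ENNReal :=
  μHE[n - relDim α] S

/-- `r₁, …, rₙ` are the local roots of `f` modulo `p`: `f ≡ ∏ (x - rᵢ) mod p` and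
`0 ≤ r₁ ≤ ⋯ ≤ rₙ < p`. -/
def IsLocalRoots (f : Polynomial ℤ) (p : ℕ) (r : Fin n → ℤ) : Prop :=
  f.map (Int.castRingHom (ZMod p))
      = ∏ i, (Polynomial.X - Polynomial.C ((r i : ℤ) : ZMod p)) ∧
    (∀ i, 0 ≤ r i ∧ r i < p) ∧ ∀ i j, i ≤ j → r i ≤ r j

/-- `Spl_X(f)`, the primes `p ≤ X` modulo which `f` is a product of linear factors. -/
def Spl (f : Polynomial ℤ) (X : ℕ) : Set ℕ :=
  {p | p.Prime ∧ p ≤ X ∧ (f.map (Int.castRingHom (ZMod p))).Splits}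

/-- `Spl_X(f, σ)`, the primes `p ∈ Spl_X(f)` whose (uniquely determined) local roots satisfy
`∑ i, m_{j,i} r_{σ(i)} ≡ mⱼ mod p` for all `j`. -/
def SplPerm (f : Polynomial ℤ) (mhat : Fin t → (Fin n → ℤ) × ℤ) (σ : Equiv.Perm (Fin n))
    (X : ℕ) : Set ℕ :=
  {p | p ∈ Spl f X ∧ ∃ r : Fin n → ℤ, IsLocalRoots f p r ∧
    ∀ j, ∑ i, (mhat j).1 i * r (σ i) ≡ (mhat j).2 [ZMOD (p : ℤ)]}

/-- The limit defining `Pr(f, σ)` exists and equals `P`. -/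
def HasDensity (f : Polynomial ℤ) (mhat : Fin t → (Fin n → ℤ) × ℤ) (σ : Equiv.Perm (Fin n))
    (P : ℝ) : Prop :=
  Filter.Tendsto (fun X : ℕ => ((SplPerm f mhat σ X).ncard : ℝ) / ((Spl f X).ncard : ℝ))
    Filter.atTop (nhds P)

end RootRelations

end

/-! Let M ⊂ ℤⁿ be the lattice spanned by the vectors `(mhat j).1`. The `α i` are algebraic integers,
so M = LR₀ ∩ ℤⁿ; hence M is saturated, and 𝔇_f consists of the x with (m, x) ∈ ℤ for all m ∈ M.
Extending a basis of M to one of ℤⁿ shows that this ℤⁿ-periodic set is a countable union of parallel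
(n-t)-planes whose volume per period is the square root of the Gram determinant of M
(`hausdorff_integralSet_inter_unitCube_of_saturated`), and that a hyperplane with integral normal
outside M meets it in a null set (`hausdorff_integralSet_inter_hyperplane_of_notMem`).

Permuting coordinates carries 𝔇(f,σ) to an order chamber of 𝔇_f ∩ [0,1]ⁿ. By the nullity statement
these chambers tile the cube part of 𝔇_f when no eᵢ and no eᵢ - eⱼ lies in M, and almost every point
of ⋃ 𝔇(f,σ) lies in 𝔇(f,σ) for exactly one coset of G.

For the constant, reduction of algebraic integers at a prime above a large p matches the `α i` with
the local roots, so exactly #Ĝ permutations satisfy the congruences (`card_perm_congruence_eq`).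
Infinitely many primes split f, hence ∑ Pr(f,σ) = #Ĝ, and summing vol 𝔇(f,σ) = c·Pr(f,σ) determines
c. -/

noncomputable section

open MeasureTheory Matrix

namespace RootRelations

/-! ### Integrality sets in unimodular coordinates, and null hyperplane sections -/

/-- The vectors of `ℝⁿ` that have integral inner product with each of the vectors `m j`. -/
def integralSet {ι : Type*} {n : ℕ} (m : ι → Fin n → ℤ) : Set (EuclideanSpace ℝ (Fin n)) :=
  {x | ∀ j, ∃ z : ℤ, ∑ i, (m j i : ℝ) * x i = z}

theorem measurableSet_integralSet {ι : Type*} [Countable ι] {n : ℕ} (m : ι → Fin n → ℤ) :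
    MeasurableSet (integralSet m) := by
  have h : integralSet m = ⋂ j, ⋃ z : ℤ,
      {x : EuclideanSpace ℝ (Fin n) | ∑ i, (m j i : ℝ) * x i = z} := by
    ext x; simp [integralSet]
  rw [h]
  refine .iInter fun j => .iUnion fun z => ?_
  exact measurableSet_eq_fun (by fun_prop) measurable_const

theorem volume_linearMap_eq_const {k : ℕ} (φ : EuclideanSpace ℝ (Fin k) →ₗ[ℝ] ℝ) (hφ : φ ≠ 0)
    (c : ℝ) : volume {y | φ y = c} = 0 := by
  rcases Set.eq_empty_or_nonempty {y | φ y = c} with h | ⟨y₀, hy₀⟩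
  · simp [h]
  · have h : {y | φ y = c} = (fun y => -y₀ + y) ⁻¹' (LinearMap.ker φ : Set _) := by
      have hy₀' : φ y₀ = c := hy₀
      ext y
      simp [hy₀']
      constructor <;> intro h <;> linarith
    rw [h, measure_preimage_add]
    exact Measure.addHaar_submodule _ _ (by rwa [Ne, LinearMap.ker_eq_top])

/-- The linear map `ℝᵏ → ℝⁿ` given by an integral matrix. -/
def intMatrixMap {n k : ℕ} (C : Matrix (Fin n) (Fin k) ℤ) :
    EuclideanSpace ℝ (Fin k) →ₗ[ℝ] EuclideanSpace ℝ (Fin n) :=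
  Matrix.toLpLin 2 2 (C.map (Int.cast : ℤ → ℝ))

theorem intMatrixMap_apply {n k : ℕ} (C : Matrix (Fin n) (Fin k) ℤ) (y : EuclideanSpace ℝ (Fin k))
    (i : Fin n) : intMatrixMap C y i = ∑ j, (C i j : ℝ) * y j := by
  simp [intMatrixMap, Matrix.mulVec, dotProduct]

theorem hausdorff_image_intMatrixMap {n k : ℕ} (C : Matrix (Fin n) (Fin k) ℤ)
    (s : Set (EuclideanSpace ℝ (Fin k))) :
    μHE[k] (intMatrixMap C '' s) = ENNReal.ofReal (intMatrixMap C).normDet * volume s := by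
  have h := (intMatrixMap C).euclideanHausdorffMeasure_image_eq_normDet_mul_volume s
  rwa [finrank_euclideanSpace_fin] at h

theorem normDet_intMatrixMap {n k : ℕ} (C : Matrix (Fin n) (Fin k) ℤ) :
    (intMatrixMap C).normDet = Real.sqrt ((Cᵀ * C).det : ℤ) := by
  have h := (intMatrixMap C).normDet_sq_eq_det_gram (EuclideanSpace.basisFun (Fin k) ℝ)
  rw [← Real.sqrt_sq (intMatrixMap C).normDet_nonneg]
  congr 1
  have h2 : Matrix.gram ℝ (fun j => intMatrixMap C (EuclideanSpace.basisFun (Fin k) ℝ j))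
      = (Cᵀ * C).map (Int.castRingHom ℝ) := by
    ext i j
    simp [Matrix.gram_apply, PiLp.inner_apply, intMatrixMap_apply, Matrix.mul_apply, mul_comm]
  rw [h2, ← RingHom.mapMatrix_apply, ← RingHom.map_det] at h
  simpa using h

section Chart

variable {n : ℕ} {ι : Type*} [Fintype ι] {A : Matrix ι (Fin n) ℤ}
  {C : Matrix (Fin n) ι ℤ}

/-- The rows of `A` serve as new coordinates on ℝⁿ, and the columns of `C` are the dual basis. Later
the first t coordinates are those required to be integers. -/
theorem chart_sum (hCA : C * A = 1) (x : Fin n → ℝ) (i : Fin n) :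
    ∑ j, (C i j : ℝ) * ∑ l, (A j l : ℝ) * x l = x i := by
  have h : (C.map (Int.castRingHom ℝ)) * (A.map (Int.castRingHom ℝ)) = 1 := by
    rw [← Matrix.map_mul, hCA]; simp
  have h2 : (C.map (Int.castRingHom ℝ)) *ᵥ ((A.map (Int.castRingHom ℝ)) *ᵥ x) = x := by
    rw [Matrix.mulVec_mulVec, h, Matrix.one_mulVec]
  simpa [Matrix.mulVec, dotProduct] using congrFun h2 i

theorem chart_sum_symm [DecidableEq ι] (hAC : A * C = 1) (y : ι → ℝ) (j : ι) :
    ∑ i, (A j i : ℝ) * ∑ l, (C i l : ℝ) * y l = y j := by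
  have h : (A.map (Int.castRingHom ℝ)) * (C.map (Int.castRingHom ℝ)) = 1 := by
    rw [← Matrix.map_mul, hAC]; simp
  have h2 : (A.map (Int.castRingHom ℝ)) *ᵥ ((C.map (Int.castRingHom ℝ)) *ᵥ y) = y := by
    rw [Matrix.mulVec_mulVec, h, Matrix.one_mulVec]
  simpa [Matrix.mulVec, dotProduct] using congrFun h2 j

end Chart

section Block

variable {n t k : ℕ} {A : Matrix (Fin t ⊕ Fin k) (Fin n) ℤ}
  {C : Matrix (Fin n) (Fin t ⊕ Fin k) ℤ}

/-- A hyperplane whose normal vector is not orthogonal to the directions of `integralSet` meets it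
in a null set. -/
theorem hausdorff_integralSet_inter_hyperplane (hCA : C * A = 1) (u : Fin n → ℤ)
    (hu : ∃ j : Fin k, ∑ i, u i * C i (Sum.inr j) ≠ 0) (c : ℝ) :
    μHE[k] (integralSet (fun j => A (Sum.inl j)) ∩
      {x : EuclideanSpace ℝ (Fin n) | ∑ i, (u i : ℝ) * x i = c}) = 0 := by
  set B : Matrix (Fin n) (Fin k) ℤ := Matrix.of fun i j => C i (Sum.inr j) with hB
  set P : (Fin t → ℤ) → EuclideanSpace ℝ (Fin n) := fun z =>
    WithLp.toLp 2 fun i => ∑ j, (C i (Sum.inl j) : ℝ) * z j with hP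
  let ψ : EuclideanSpace ℝ (Fin n) →ₗ[ℝ] ℝ :=
    { toFun := fun x => ∑ i, (u i : ℝ) * x i
      map_add' := fun x y => by simp [mul_add, Finset.sum_add_distrib]
      map_smul' := fun a x => by simp [Finset.mul_sum, mul_left_comm] }
  have hψ : ψ ∘ₗ intMatrixMap B ≠ 0 := by
    obtain ⟨j, hj⟩ := hu
    intro h0
    apply hj
    have h1 := LinearMap.congr_fun h0 (EuclideanSpace.single j 1)
    simp only [LinearMap.comp_apply, ψ, LinearMap.coe_mk, AddHom.coe_mk, intMatrixMap_apply,
      LinearMap.zero_apply] at h1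
    simp [hB] at h1
    exact_mod_cast h1
  -- Fixing the integer values z of the first t coordinates leaves a translate by `P z` of the span
  -- of the last k columns of `C`. On it the hyperplane is a level set of a nonzero functional.
  have hsub : (integralSet (fun j => A (Sum.inl j)) ∩
      {x : EuclideanSpace ℝ (Fin n) | ∑ i, (u i : ℝ) * x i = c}) ⊆
      ⋃ z : Fin t → ℤ, (fun x => P z + x) ''
        (intMatrixMap B '' {y | (ψ ∘ₗ intMatrixMap B) y = c - ψ (P z)}) := by
    rintro x ⟨hx, hxc⟩
    choose z hz using hx
    have hxe : P z + intMatrixMap B (WithLp.toLp 2 fun j => ∑ l, (A (Sum.inr j) l : ℝ) * x l)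
        = x := by
      ext i
      rw [PiLp.add_apply, intMatrixMap_apply, ← chart_sum hCA x i, Fintype.sum_sum_type]
      simp [hP, hB, hz]
    refine Set.mem_iUnion.2 ⟨z, _, ⟨_, ?_, rfl⟩, hxe⟩
    have hxc' : ψ x = c := hxc
    rw [Set.mem_ofPred_eq, LinearMap.comp_apply, eq_sub_iff_add_eq', ← map_add, hxe, hxc']
  refine measure_mono_null hsub (measure_iUnion_null fun z => ?_)
  rw [(isometry_add_left (P z)).euclideanHausdorffMeasure_image, hausdorff_image_intMatrixMap,
    volume_linearMap_eq_const _ hψ, mul_zero]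

end Block

end RootRelations

end

/-! ### Fundamental domains for ℤⁿ and the volume per period -/

noncomputable section

open MeasureTheory Matrix

namespace RootRelations

/-- The embedding of `ℤⁿ` into `ℝⁿ`. -/
def intVecHom (n : ℕ) : (Fin n → ℤ) →+ EuclideanSpace ℝ (Fin n) where
  toFun z := WithLp.toLp 2 fun i => (z i : ℝ)
  map_zero' := by ext; simp
  map_add' x y := by ext; simp

theorem intVecHom_apply {n : ℕ} (z : Fin n → ℤ) (i : Fin n) : intVecHom n z i = z i := rfl

instance countable_intVecHom_range (n : ℕ) : Countable (intVecHom n).range :=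
  (Set.countable_range (intVecHom n)).to_subtype

theorem exists_unique_int_add_mem_Ico {ι : Type*} (y : ι → ℝ) :
    ∃! z : ι → ℤ, ∀ i, (z i : ℝ) + y i ∈ Set.Ico (0 : ℝ) 1 := by
  refine ⟨fun i => -⌊y i⌋, fun i => ?_, fun z hz => funext fun i => ?_⟩
  · have h1 := Int.floor_le (y i)
    have h2 := Int.lt_floor_add_one (y i)
    push_cast
    constructor <;> linarith
  · have h := hz i
    rw [eq_neg_iff_add_eq_zero, add_comm, ← eq_neg_iff_add_eq_zero, Int.floor_eq_iff]
    push_cast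
    constructor <;> linarith [h.1, h.2]

/-- The half-open parallelepiped of a unimodular matrix is a fundamental domain for `ℤⁿ`. -/
theorem isAddFundamentalDomain_unimodular {n : ℕ} {ι : Type*} [Fintype ι] [DecidableEq ι]
    {A : Matrix ι (Fin n) ℤ} {C : Matrix (Fin n) ι ℤ} (hAC : A * C = 1) (hCA : C * A = 1)
    (μ : Measure (EuclideanSpace ℝ (Fin n))) :
    IsAddFundamentalDomain (intVecHom n).range
      {x : EuclideanSpace ℝ (Fin n) | ∀ j, ∑ l, (A j l : ℝ) * x l ∈ Set.Ico (0 : ℝ) 1} μ := by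
  refine IsAddFundamentalDomain.mk' ?_ fun x => ?_
  · refine MeasurableSet.nullMeasurableSet ?_
    rw [Set.ofPred_forall]
    refine MeasurableSet.iInter fun j => ?_
    have hm : Measurable fun x : EuclideanSpace ℝ (Fin n) => ∑ l, (A j l : ℝ) * x l := by fun_prop
    exact hm measurableSet_Ico
  · obtain ⟨z, hz, hzu⟩ := exists_unique_int_add_mem_Ico fun j => ∑ l, (A j l : ℝ) * x l
    -- The lattice vector whose coordinates with respect to `A` are z.
    refine ⟨⟨intVecHom n (C *ᵥ z), _, rfl⟩, fun j => ?_, ?_⟩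
    · have h := chart_sum_symm hAC (fun j => (z j : ℝ)) j
      convert hz j using 1
      rw [← h, ← Finset.sum_add_distrib]
      refine Finset.sum_congr rfl fun l _ => ?_
      simp [AddSubgroup.vadd_def, intVecHom_apply, Matrix.mulVec, dotProduct, mul_add]
    · rintro ⟨_, w, rfl⟩ hw
      have hw' : A *ᵥ w = z := hzu _ fun j => by
        convert hw j using 1
        simp [AddSubgroup.vadd_def, intVecHom_apply, Matrix.mulVec, dotProduct, mul_add,
          Finset.sum_add_distrib]
      simp [← hw', Matrix.mulVec_mulVec, hCA]

theorem isAddFundamentalDomain_unitCube {n : ℕ} (μ : Measure (EuclideanSpace ℝ (Fin n))) :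
    IsAddFundamentalDomain (intVecHom n).range (unitCube n) μ := by
  have h := isAddFundamentalDomain_unimodular (one_mul (1 : Matrix (Fin n) (Fin n) ℤ))
    (one_mul 1) μ
  convert h using 1
  ext x
  simp [unitCube, Matrix.one_apply]

theorem vadd_preimage_integralSet {ι : Type*} {n : ℕ} (m : ι → Fin n → ℤ)
    (g : (intVecHom n).range) : (fun x => g +ᵥ x) ⁻¹' integralSet m = integralSet m := by
  obtain ⟨_, w, rfl⟩ := g
  ext x
  have key : ∀ j, ∑ i, (m j i : ℝ) * (intVecHom n w + x) i
      = ((∑ i, m j i * w i : ℤ) : ℝ) + ∑ i, (m j i : ℝ) * x i := fun j => by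
    simp [intVecHom_apply, mul_add, Finset.sum_add_distrib]
  simp only [integralSet, AddSubgroup.vadd_def, vadd_eq_add, Set.mem_preimage, Set.mem_ofPred_eq,
    key]
  refine forall_congr' fun j => ⟨?_, ?_⟩
  · rintro ⟨z, hz⟩
    exact ⟨z - ∑ i, m j i * w i, by push_cast at hz ⊢; linarith⟩
  · rintro ⟨z, hz⟩
    exact ⟨∑ i, m j i * w i + z, by push_cast at hz ⊢; linarith⟩

theorem volume_setOf_forall_mem_Ico (k : ℕ) :
    volume {y : EuclideanSpace ℝ (Fin k) | ∀ j, y j ∈ Set.Ico (0 : ℝ) 1} = 1 := by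
  have h := (EuclideanSpace.volume_preserving_symm_measurableEquiv_toLp (Fin k)).symm
  rw [← h.measure_preimage_equiv]
  have : (MeasurableEquiv.toLp 2 (Fin k → ℝ)).symm.symm ⁻¹'
      {y : EuclideanSpace ℝ (Fin k) | ∀ j, y j ∈ Set.Ico (0 : ℝ) 1}
      = Set.univ.pi fun _ => Set.Ico (0 : ℝ) 1 := by
    ext y; simp
  rw [this, volume_pi_pi]
  simp

/-- The complementary minors of a pair of mutually inverse integral matrices agree up to sign. -/
theorem abs_det_toBlocks_eq {ι κ : Type*} [Fintype ι] [Fintype κ] [DecidableEq ι] [DecidableEq κ]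
    {S X : Matrix (ι ⊕ κ) (ι ⊕ κ) ℤ} (h : S * X = 1) :
    |X.toBlocks₂₂.det| = |S.toBlocks₁₁.det| := by
  have hdet : |S.det| = 1 := by
    have h1 := congrArg Matrix.det h
    rw [Matrix.det_mul, Matrix.det_one] at h1
    exact Int.isUnit_iff_abs_eq.1 (IsUnit.of_mul_eq_one _ h1)
  have hb := h
  rw [← Matrix.fromBlocks_toBlocks S, ← Matrix.fromBlocks_toBlocks X, Matrix.fromBlocks_multiply,
    ← Matrix.fromBlocks_one, Matrix.fromBlocks_inj] at hb
  -- Replacing the first block column of `X` by that of the identity makes both sides block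
  -- triangular, so determinants can be compared.
  have hp : S * Matrix.fromBlocks 1 X.toBlocks₁₂ 0 X.toBlocks₂₂
      = Matrix.fromBlocks S.toBlocks₁₁ 0 S.toBlocks₂₁ 1 := by
    conv_lhs => rw [← Matrix.fromBlocks_toBlocks S]
    rw [Matrix.fromBlocks_multiply, hb.2.1, hb.2.2.2]
    simp
  have hd := congrArg Matrix.det hp
  rw [Matrix.det_mul, Matrix.det_fromBlocks_zero₂₁, Matrix.det_fromBlocks_zero₁₂, Matrix.det_one,
    Matrix.det_one, one_mul, mul_one] at hd
  rw [← hd, abs_mul, hdet, one_mul]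

section Block

variable {n t k : ℕ} {A : Matrix (Fin t ⊕ Fin k) (Fin n) ℤ}
  {C : Matrix (Fin n) (Fin t ⊕ Fin k) ℤ}

/-- An integer in [0,1) is 0, so the first t coordinates vanish and only a cube in the remaining k
survives. -/
theorem integralSet_inter_unimodular (hAC : A * C = 1) (hCA : C * A = 1) :
    integralSet (fun j => A (Sum.inl j)) ∩
      {x : EuclideanSpace ℝ (Fin n) | ∀ j, ∑ l, (A j l : ℝ) * x l ∈ Set.Ico (0 : ℝ) 1}
    = intMatrixMap (Matrix.of fun i j => C i (Sum.inr j)) ''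
      {y : EuclideanSpace ℝ (Fin k) | ∀ j, y j ∈ Set.Ico (0 : ℝ) 1} := by
  ext x
  constructor
  · rintro ⟨hx, hxc⟩
    have h0 : ∀ j, ∑ l, (A (Sum.inl j) l : ℝ) * x l = 0 := fun j => by
      obtain ⟨z, hz⟩ := hx j
      have h1 := hxc (Sum.inl j)
      rw [hz] at h1 ⊢
      have h2 : (0 : ℤ) ≤ z := by exact_mod_cast h1.1
      have h3 : z < 1 := by exact_mod_cast h1.2
      have h4 : z = 0 := by lia
      simp [h4]
    refine ⟨WithLp.toLp 2 fun j => ∑ l, (A (Sum.inr j) l : ℝ) * x l, fun j => hxc _, ?_⟩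
    ext i
    rw [intMatrixMap_apply, ← chart_sum hCA x i, Fintype.sum_sum_type]
    simp [h0]
  · rintro ⟨y, hy, rfl⟩
    have key : ∀ j, ∑ l, (A j l : ℝ) *
        intMatrixMap (Matrix.of fun i j => C i (Sum.inr j)) y l = Sum.elim (fun _ => 0) y j := by
      intro j
      rw [← chart_sum_symm hAC (Sum.elim (fun _ => 0) y) j]
      refine Finset.sum_congr rfl fun l _ => ?_
      simp [intMatrixMap_apply]
    refine ⟨fun j => ⟨0, by rw [key]; simp⟩, fun j => ?_⟩
    rw [key]
    cases j with
    | inl j => simp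
    | inr j => exact hy j

/-- The set is ℤⁿ-periodic, so the unit cube may be exchanged for the parallelepiped of `A`. The
volume found there is a Gram determinant of columns of `C`; since A Aᵀ and Cᵀ C are inverse,
complementary minors turn it into that of the first t rows of `A`. -/
theorem hausdorff_integralSet_inter_unitCube (hAC : A * C = 1) (hCA : C * A = 1) :
    μHE[k] (integralSet (fun j => A (Sum.inl j)) ∩ unitCube n)
      = ENNReal.ofReal (Real.sqrt
        (Matrix.of fun i j : Fin t => ∑ l, A (Sum.inl i) l * A (Sum.inl j) l).det) := by
  rw [(isAddFundamentalDomain_unitCube μHE[k]).measure_set_eq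
    (isAddFundamentalDomain_unimodular hAC hCA μHE[k]) (measurableSet_integralSet _)
    (vadd_preimage_integralSet _), integralSet_inter_unimodular hAC hCA,
    hausdorff_image_intMatrixMap, volume_setOf_forall_mem_Ico, mul_one, normDet_intMatrixMap]
  have hSX : (A * Aᵀ) * (Cᵀ * C) = 1 := by
    rw [Matrix.mul_assoc, ← Matrix.mul_assoc Aᵀ, ← Matrix.transpose_mul, hCA,
      Matrix.transpose_one, Matrix.one_mul, hAC]
  have h := abs_det_toBlocks_eq hSX
  have hX : (Cᵀ * C).toBlocks₂₂ = (Matrix.of fun i j => C i (Sum.inr j) : Matrix _ (Fin k) ℤ)ᵀ *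
      Matrix.of fun i j => C i (Sum.inr j) := by
    ext i j; simp [Matrix.toBlocks₂₂, Matrix.mul_apply]
  have hS : (A * Aᵀ).toBlocks₁₁
      = Matrix.of fun i j : Fin t => ∑ l, A (Sum.inl i) l * A (Sum.inl j) l := by
    ext i j; simp [Matrix.toBlocks₁₁, Matrix.mul_apply]
  have hnn : ∀ {p q : ℕ} (M : Matrix (Fin p) (Fin q) ℤ), 0 ≤ (M * Mᵀ).det := fun M => by
    have h1 := (Matrix.posSemidef_self_mul_conjTranspose (M.map (Int.castRingHom ℝ))).det_nonneg
    have h2 : M.map (Int.castRingHom ℝ) * (M.map (Int.castRingHom ℝ))ᴴ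
        = (M * Mᵀ).map (Int.castRingHom ℝ) := by
      ext i j; simp [Matrix.mul_apply]
    rw [h2, ← RingHom.mapMatrix_apply, ← RingHom.map_det] at h1
    simpa using h1
  rw [hX, hS, abs_of_nonneg, abs_of_nonneg] at h
  · rw [h]
  · have h2 := hnn (Matrix.of fun (j : Fin t) l => A (Sum.inl j) l)
    have h3 : (Matrix.of fun (j : Fin t) l => A (Sum.inl j) l) *
        (Matrix.of fun (j : Fin t) l => A (Sum.inl j) l)ᵀ
        = Matrix.of fun i j : Fin t => ∑ l, A (Sum.inl i) l * A (Sum.inl j) l :=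
      Matrix.ext fun i j => by simp [Matrix.mul_apply]
    rwa [h3] at h2
  · have h2 := hnn (Matrix.of fun i j => C i (Sum.inr j) : Matrix _ (Fin k) ℤ)ᵀ
    rwa [Matrix.transpose_transpose] at h2

end Block

end RootRelations

end

/-! ### Saturated sublattices of ℤⁿ -/

noncomputable section

open MeasureTheory Matrix

namespace RootRelations

section Lattice

variable {n t : ℕ} {m : Fin t → Fin n → ℤ}

/-- Linearly independent vectors spanning a saturated sublattice of `ℤⁿ` are the first rows of a
unimodular matrix. -/
theorem exists_unimodular_extension (hli : LinearIndependent ℤ m)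
    (hsat : ∀ (a : ℤ) (v : Fin n → ℤ), a ≠ 0 → a • v ∈ Submodule.span ℤ (Set.range m) →
      v ∈ Submodule.span ℤ (Set.range m)) :
    ∃ (A : Matrix (Fin t ⊕ Fin (n - t)) (Fin n) ℤ) (C : Matrix (Fin n) (Fin t ⊕ Fin (n - t)) ℤ),
      A * C = 1 ∧ C * A = 1 ∧ ∀ j, A (Sum.inl j) = m j := by
  -- Saturation says that the quotient is torsion-free, hence free over ℤ, so a basis of it lifts
  -- and completes `m`.
  have : Module.IsTorsionFree ℤ ((Fin n → ℤ) ⧸ Submodule.span ℤ (Set.range m)) := by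
    refine Module.IsTorsionFree.of_smul_eq_zero fun a x h => ?_
    obtain ⟨v, rfl⟩ := Submodule.Quotient.mk_surjective _ x
    rw [or_iff_not_imp_left]
    intro ha
    rw [← Submodule.Quotient.mk_smul, Submodule.Quotient.mk_eq_zero] at h
    exact (Submodule.Quotient.mk_eq_zero _).2 (hsat a v ha h)
  have hfree : Module.Free ℤ ((Fin n → ℤ) ⧸ Submodule.span ℤ (Set.range m)) :=
    Module.free_of_finite_type_torsion_free'
  let b := (Module.Basis.span hli).sumQuot
    (Module.finBasis ℤ ((Fin n → ℤ) ⧸ Submodule.span ℤ (Set.range m)))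
  have hb : ∀ j, b (Sum.inl j) = m j := fun j => by
    simp [b, Module.Basis.sumQuot_inl, Module.Basis.span_apply]
  have hcard := Module.finrank_eq_card_basis b
  rw [Module.finrank_fin_fun, Fintype.card_sum, Fintype.card_fin, Fintype.card_fin] at hcard
  have hk : Module.finrank ℤ ((Fin n → ℤ) ⧸ Submodule.span ℤ (Set.range m)) = n - t := by lia
  let b' : Module.Basis (Fin t ⊕ Fin (n - t)) ℤ (Fin n → ℤ) :=
    b.reindex (Equiv.sumCongr (Equiv.refl _) (finCongr hk))
  have hb' : ∀ j, b' (Sum.inl j) = m j := fun j => by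
    simp [b', Module.Basis.reindex_apply, hb]
  refine ⟨((Pi.basisFun ℤ (Fin n)).toMatrix b')ᵀ, (b'.toMatrix (Pi.basisFun ℤ (Fin n)))ᵀ, ?_, ?_,
    fun j => ?_⟩
  · rw [← Matrix.transpose_mul, Module.Basis.toMatrix_mul_toMatrix_flip, Matrix.transpose_one]
  · rw [← Matrix.transpose_mul, Module.Basis.toMatrix_mul_toMatrix_flip, Matrix.transpose_one]
  · ext i
    simp [Module.Basis.toMatrix_apply, hb']

/-- A hyperplane whose integral normal vector lies outside a saturated lattice meets the set of
vectors that are integral on the lattice in a null set. -/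
theorem hausdorff_integralSet_inter_hyperplane_of_notMem (hli : LinearIndependent ℤ m)
    (hsat : ∀ (a : ℤ) (v : Fin n → ℤ), a ≠ 0 → a • v ∈ Submodule.span ℤ (Set.range m) →
      v ∈ Submodule.span ℤ (Set.range m))
    {u : Fin n → ℤ}
    (hu : u ∉ Submodule.span ℤ (Set.range m)) (c : ℝ) :
    μHE[n - t] (integralSet m ∩ {x : EuclideanSpace ℝ (Fin n) | ∑ i, (u i : ℝ) * x i = c}) = 0 := by
  obtain ⟨A, C, hAC, hCA, hA⟩ := exists_unimodular_extension hli hsat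
  have h := hausdorff_integralSet_inter_hyperplane hCA u ?_ c
  · simpa only [hA] using h
  -- If all the last n-t coordinates of u in the basis of rows of `A` vanish, then u is a
  -- combination of the `m j`.
  by_contra! h0
  refine hu ?_
  have h1 : u = ∑ j, (u ᵥ* C) j • A j := by
    rw [← Matrix.vecMul_eq_sum, Matrix.vecMul_vecMul, hCA, Matrix.vecMul_one]
  rw [h1, Fintype.sum_sum_type]
  refine add_mem (Submodule.sum_mem _ fun j _ => Submodule.smul_mem _ _ ?_)
    (Submodule.sum_mem _ fun j _ => ?_)
  · exact hA j ▸ Submodule.subset_span ⟨j, rfl⟩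
  · have h2 : (u ᵥ* C) (Sum.inr j) = 0 := h0 j
    simp [h2]

theorem hausdorff_integralSet_inter_unitCube_of_saturated (hli : LinearIndependent ℤ m)
    (hsat : ∀ (a : ℤ) (v : Fin n → ℤ), a ≠ 0 → a • v ∈ Submodule.span ℤ (Set.range m) →
      v ∈ Submodule.span ℤ (Set.range m)) :
    μHE[n - t] (integralSet m ∩ unitCube n) = ENNReal.ofReal (Real.sqrt
      (Matrix.of fun i j : Fin t => ∑ l, (m i l : ℝ) * (m j l : ℝ)).det) := by
  obtain ⟨A, C, hAC, hCA, hA⟩ := exists_unimodular_extension hli hsat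
  have h := hausdorff_integralSet_inter_unitCube hAC hCA
  simp only [hA] at h
  rw [h, ← eq_intCast (Int.castRingHom ℝ), RingHom.map_det]
  congr 3
  ext i j
  simp

end Lattice

end RootRelations

end

/-! ### Symmetry groups and the lattice of relations -/

noncomputable section

open MeasureTheory Matrix

namespace RootRelations

/-- In a finite group σ⁻¹ is a power of σ, so a submodule stable under σ is stable under σ⁻¹. -/
theorem map_eq_of_forall_mem_of_finite {G V : Type*} [Group G] [Finite G] [AddCommGroup V]
    (ρ : Representation ℤ G V) {M : Submodule ℤ V} {σ : G} (h : ∀ x ∈ M, ρ σ x ∈ M) :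
    M.map (ρ σ) = M := by
  let S : Submonoid G :=
    { carrier := {τ | ∀ x ∈ M, ρ τ x ∈ M}
      one_mem' := by simp
      mul_mem' := fun {a b} ha hb x hx => by
        rw [map_mul]; exact ha _ (hb _ hx) }
  have hinv : σ⁻¹ ∈ S := by
    have h1 : σ⁻¹ ∈ Submonoid.powers σ := by
      rw [mem_powers_iff_mem_zpowers]
      exact inv_mem (Subgroup.mem_zpowers σ)
    exact (Submonoid.powers_le.2 (show σ ∈ S from h)) h1
  refine le_antisymm (Submodule.map_le_iff_le_comap.2 h) fun x hx => ?_
  exact ⟨ρ σ⁻¹ x, hinv x hx, by simp⟩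

theorem map_span_eq_iff_of_finite {G V ι : Type*} [Group G] [Finite G] [AddCommGroup V]
    (ρ : Representation ℤ G V) (v : ι → V) (σ : G) :
    Submodule.span ℤ (Set.range fun j => ρ σ (v j)) = Submodule.span ℤ (Set.range v) ↔
      ∀ j, ρ σ (v j) ∈ Submodule.span ℤ (Set.range v) := by
  constructor
  · intro h j
    rw [← h]
    exact Submodule.subset_span ⟨j, rfl⟩
  · intro h
    have h1 : ∀ x ∈ Submodule.span ℤ (Set.range v), ρ σ x ∈ Submodule.span ℤ (Set.range v) := by
      intro x hx
      have h2 : Submodule.span ℤ (Set.range v) ≤ (Submodule.span ℤ (Set.range v)).comap (ρ σ) :=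
        Submodule.span_le.2 (by rintro _ ⟨j, rfl⟩; exact h j)
      exact h2 hx
    conv_rhs => rw [← map_eq_of_forall_mem_of_finite ρ h1]
    rw [Submodule.map_span, ← Set.range_comp]
    rfl

/-- The permutation representation on `ℤⁿ`. -/
def permRep (n : ℕ) : Representation ℤ (Equiv.Perm (Fin n)) (Fin n → ℤ) where
  toFun σ := LinearMap.funLeft ℤ ℤ ⇑σ⁻¹
  map_one' := by ext; simp [LinearMap.funLeft]
  map_mul' σ τ := by ext; simp [LinearMap.funLeft]

/-- The permutation representation on `ℤⁿ × ℤ`, acting trivially on the last coordinate. -/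
def permRepHat (n : ℕ) : Representation ℤ (Equiv.Perm (Fin n)) ((Fin n → ℤ) × ℤ) where
  toFun σ := (permRep n σ).prodMap LinearMap.id
  map_one' := by rw [map_one]; rfl
  map_mul' σ τ := by rw [map_mul]; rfl

theorem permRepHat_apply {n : ℕ} (σ : Equiv.Perm (Fin n)) (x : (Fin n → ℤ) × ℤ) :
    permRepHat n σ x = (permVec σ x.1, x.2) := rfl

theorem sum_permVec_mul {n : ℕ} {R : Type*} [Ring R] (σ : Equiv.Perm (Fin n)) (m : Fin n → ℤ)
    (x : Fin n → R) : ∑ i, (permVec σ m i : R) * x i = ∑ i, (m i : R) * x (σ i) := by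
  rw [← Equiv.sum_comp σ]
  simp [permVec]

section Relations

variable {n t : ℕ} {α : Fin n → ℂ} {mhat : Fin t → (Fin n → ℤ) × ℤ}

theorem mem_groupG_iff (σ : Equiv.Perm (Fin n)) : σ ∈ groupG mhat ↔
    ∀ j, permVec σ (mhat j).1 ∈ Submodule.span ℤ (Set.range fun j => (mhat j).1) :=
  map_span_eq_iff_of_finite (permRep n) (fun j => (mhat j).1) σ

theorem mem_intLR_iff (x : (Fin n → ℤ) × ℤ) :
    x ∈ intLR α ↔ ∑ i, (x.1 i : ℂ) * α i = x.2 := by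
  change (∑ i, (((x.1 i : ℤ) : ℚ) : ℂ) * α i = (((x.2 : ℤ) : ℚ) : ℂ)) ↔ _
  simp

theorem mem_groupGhat_iff (hm : IsRelBasis α mhat) (σ : Equiv.Perm (Fin n)) :
    σ ∈ groupGhat mhat ↔ ∀ j, ∑ i, ((mhat j).1 i : ℂ) * α (σ i) = (mhat j).2 := by
  refine (map_span_eq_iff_of_finite (permRepHat n) mhat σ).trans (forall_congr' fun j => ?_)
  rw [hm.span_eq, permRepHat_apply, mem_intLR_iff, sum_permVec_mul]

/-- A relation with zero coefficients has right-hand side zero, so forgetting the last coordinate is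
injective on relations. -/
theorem linearIndependent_fst (hm : IsRelBasis α mhat) :
    LinearIndependent ℤ fun j => (mhat j).1 := by
  refine hm.linearIndependent.map (f := LinearMap.fst ℤ (Fin n → ℤ) ℤ) ?_
  rw [hm.span_eq, Submodule.disjoint_def]
  rintro ⟨x, z⟩ hx h0
  have hx0 : x = 0 := h0
  rw [mem_intLR_iff] at hx
  simp only [hx0, Pi.zero_apply, Int.cast_zero, zero_mul, Finset.sum_const_zero] at hx
  have hz : z = 0 := by exact_mod_cast hx.symm
  simp [hx0, hz]

/-- An integral combination of algebraic integers that is rational is an integer, so every integral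
vector of LR₀ extends to an integral relation. -/
theorem mem_span_fst_iff (hm : IsRelBasis α mhat) (hα : ∀ i, IsIntegral ℤ (α i))
    (l : Fin n → ℤ) : l ∈ Submodule.span ℤ (Set.range fun j => (mhat j).1) ↔
      (fun i => (l i : ℚ)) ∈ LR₀ α := by
  have h1 : Submodule.span ℤ (Set.range fun j => (mhat j).1)
      = (intLR α).map (LinearMap.fst ℤ (Fin n → ℤ) ℤ) := by
    rw [← hm.span_eq, Submodule.map_span, ← Set.range_comp]
    rfl
  have h2 : (fun i => (l i : ℚ)) ∈ LR₀ α ↔ ∃ q : ℚ, ∑ i, (l i : ℂ) * α i = q := by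
    change (∃ q : ℚ, ∑ i, (((l i : ℤ) : ℚ) : ℂ) * α i = q) ↔ _
    simp
  rw [h1, h2]
  constructor
  · rintro ⟨⟨x, z⟩, hx, rfl⟩
    exact ⟨z, by simpa using (mem_intLR_iff _).1 hx⟩
  · rintro ⟨q, hq⟩
    have hint : IsIntegral ℤ (algebraMap ℚ ℂ q) := by
      rw [eq_ratCast, ← hq]
      refine IsIntegral.sum _ fun i _ => IsIntegral.mul ?_ (hα i)
      exact isIntegral_algebraMap (R := ℤ) (x := l i)
    rw [isIntegral_algebraMap_iff (algebraMap ℚ ℂ).injective,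
      IsIntegrallyClosed.isIntegral_iff] at hint
    obtain ⟨z, rfl⟩ := hint
    exact ⟨(l, z), (mem_intLR_iff _).2 (by simpa using hq), rfl⟩

theorem mem_span_fst_of_smul_mem (hm : IsRelBasis α mhat) (hα : ∀ i, IsIntegral ℤ (α i))
    (a : ℤ) (v : Fin n → ℤ) (ha : a ≠ 0)
    (h : a • v ∈ Submodule.span ℤ (Set.range fun j => (mhat j).1)) :
    v ∈ Submodule.span ℤ (Set.range fun j => (mhat j).1) := by
  rw [mem_span_fst_iff hm hα] at h ⊢
  have ha' : (a : ℚ) ≠ 0 := by exact_mod_cast ha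
  rw [← (LR₀ α).smul_mem_iff ha']
  convert h using 1
  ext i
  simp

theorem exists_int_eq_of_mem_span {ι : Type*} {m : ι → Fin n → ℤ} {x : EuclideanSpace ℝ (Fin n)}
    (h : x ∈ integralSet m) {l : Fin n → ℤ} (hl : l ∈ Submodule.span ℤ (Set.range m)) :
    ∃ z : ℤ, ∑ i, (l i : ℝ) * x i = z := by
  induction hl using Submodule.span_induction with
  | mem l hl => obtain ⟨j, rfl⟩ := hl; exact h j
  | zero => exact ⟨0, by simp⟩
  | add l₁ l₂ _ _ h₁ h₂ =>
    obtain ⟨z₁, h₁⟩ := h₁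
    obtain ⟨z₂, h₂⟩ := h₂
    exact ⟨z₁ + z₂, by simp [add_mul, Finset.sum_add_distrib, h₁, h₂]⟩
  | smul a l _ h =>
    obtain ⟨z, h⟩ := h
    exact ⟨a * z, by simp [mul_assoc, ← Finset.mul_sum, h]⟩

theorem fullDomain_eq (hm : IsRelBasis α mhat) (hα : ∀ i, IsIntegral ℤ (α i)) :
    fullDomain α = integralSet fun j => (mhat j).1 := by
  ext x
  have h1 : x ∈ fullDomain α ↔ ∀ l ∈ Submodule.span ℤ (Set.range fun j => (mhat j).1),
      ∃ z : ℤ, ∑ i, (l i : ℝ) * x i = z := by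
    simp only [mem_span_fst_iff hm hα, fullDomain, Set.mem_ofPred_eq, mul_comm]
  rw [h1]
  refine ⟨fun h j => h _ (Submodule.subset_span ⟨j, rfl⟩), fun h l hl => ?_⟩
  exact exists_int_eq_of_mem_span h hl

end Relations

end RootRelations

end

/-! ### Multiplicity of the domains and comparison of volumes -/

noncomputable section

open MeasureTheory Matrix

namespace RootRelations

/-- If almost every point of the union of finitely many sets lies in exactly `g` of them, then the
measures of the sets add up to `g` times the measure of the union. -/
theorem card_mul_measure_iUnion {Ω κ : Type*} [MeasurableSpace Ω] [Fintype κ] {μ : Measure Ω}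
    {D : κ → Set Ω} (hD : ∀ σ, MeasurableSet (D σ)) (g : ℕ)
    (h : ∀ᵐ x ∂μ, x ∈ ⋃ σ, D σ → Nat.card {σ // x ∈ D σ} = g) :
    (g : ENNReal) * μ (⋃ σ, D σ) = ∑ σ, μ (D σ) := by
  classical
  -- Both sides are integrals of the function counting the sets that contain x.
  have h1 : ∑ σ, μ (D σ) = ∫⁻ x, ∑ σ, (D σ).indicator 1 x ∂μ := by
    rw [lintegral_finsetSum _ fun σ _ => measurable_one.indicator (hD σ)]
    simp [lintegral_indicator_one (hD _)]
  rw [h1, ← lintegral_indicator_one (MeasurableSet.iUnion hD),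
    ← lintegral_const_mul _ (measurable_one.indicator (MeasurableSet.iUnion hD))]
  refine lintegral_congr_ae (h.mono fun x hx => ?_)
  have h2 : ∑ σ, (D σ).indicator (1 : Ω → ENNReal) x = (Nat.card {σ // x ∈ D σ} : ℕ) := by
    rw [Nat.card_eq_fintype_card, Fintype.card_subtype]
    simp [Set.indicator_apply, Finset.sum_boole]
  by_cases hu : x ∈ ⋃ σ, D σ
  · simp only [h2, hx hu, Set.indicator_of_mem hu, Pi.one_apply, mul_one]
  · have h3 : ∀ σ, x ∉ D σ := by simpa using hu
    simp [Set.indicator_of_notMem, h3]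

/-- The isometry `x ↦ x ∘ σ` of `ℝⁿ`. -/
def permIso {n : ℕ} (σ : Equiv.Perm (Fin n)) :
    EuclideanSpace ℝ (Fin n) ≃ᵢ EuclideanSpace ℝ (Fin n) :=
  (LinearIsometryEquiv.piLpCongrLeft 2 ℝ ℝ σ.symm).toIsometryEquiv

theorem permIso_apply {n : ℕ} (σ : Equiv.Perm (Fin n)) (x : EuclideanSpace ℝ (Fin n)) (i : Fin n) :
    permIso σ x i = x (σ i) := by
  simp [permIso, Equiv.piCongrLeft']

theorem hausdorff_preimage_permIso {n d : ℕ} (σ : Equiv.Perm (Fin n))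
    (s : Set (EuclideanSpace ℝ (Fin n))) : μHE[d] (permIso σ ⁻¹' s) = μHE[d] s :=
  ((permIso σ).measurePreserving_euclideanHausdorffMeasure d).measure_preimage_equiv
    (f := (permIso σ).toHomeomorph.toMeasurableEquiv) s

section Domains

variable {n t : ℕ} {mhat : Fin t → (Fin n → ℤ) × ℤ}

/-- The points `y` of `𝔇_f` in the unit cube that are sorted by `σ`. -/
def permutedDomain (mhat : Fin t → (Fin n → ℤ) × ℤ) (σ : Equiv.Perm (Fin n)) :
    Set (EuclideanSpace ℝ (Fin n)) :=
  {y | (∀ i, y i ∈ Set.Icc (0 : ℝ) 1) ∧ Monotone (y ∘ σ.symm)} ∩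
    integralSet fun j => (mhat j).1

/-- After this isometry the integrality conditions no longer depend on σ; only the order chamber
does. -/
theorem sortedDomain_eq_preimage (σ : Equiv.Perm (Fin n)) :
    sortedDomain mhat σ = permIso σ ⁻¹' permutedDomain mhat σ := by
  ext x
  simp only [sortedDomain, permutedDomain, integralSet, Set.mem_ofPred_eq, Set.mem_preimage,
    Set.mem_inter_iff, permIso_apply, and_assoc]
  refine and_congr ⟨fun h i => h _, fun h i => by simpa using h (σ.symm i)⟩
    (and_congr_left' ⟨fun h i j hij => ?_, fun h i j hij => ?_⟩)
  · simpa [permIso_apply] using h i j hij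
  · simpa [permIso_apply] using h hij

theorem measurableSet_permutedDomain (σ : Equiv.Perm (Fin n)) :
    MeasurableSet (permutedDomain mhat σ) := by
  refine MeasurableSet.inter ?_ (measurableSet_integralSet _)
  have h : {y : EuclideanSpace ℝ (Fin n) | (∀ i, y i ∈ Set.Icc (0 : ℝ) 1) ∧ Monotone (y ∘ σ.symm)}
      = (⋂ i, {y | y i ∈ Set.Icc (0 : ℝ) 1}) ∩
        ⋂ i, ⋂ j, ⋂ _ : i ≤ j, {y | y (σ.symm i) ≤ y (σ.symm j)} := by
    ext y
    simp [Monotone]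
  rw [h]
  refine (MeasurableSet.iInter fun i => ?_).inter
    (.iInter fun i => .iInter fun j => .iInter fun _ => measurableSet_le (by fun_prop) (by fun_prop))
  have hm : Measurable fun y : EuclideanSpace ℝ (Fin n) => y i := by fun_prop
  exact hm measurableSet_Icc

theorem measurableSet_sortedDomain (σ : Equiv.Perm (Fin n)) :
    MeasurableSet (sortedDomain mhat σ) := by
  rw [sortedDomain_eq_preimage]
  exact (permIso σ).continuous.measurable (measurableSet_permutedDomain σ)

theorem mem_sortedDomain_mul {σ g : Equiv.Perm (Fin n)} (hg : g ∈ groupG mhat)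
    {x : EuclideanSpace ℝ (Fin n)} (hx : x ∈ sortedDomain mhat σ) :
    x ∈ sortedDomain mhat (σ * g) := by
  refine ⟨hx.1, hx.2.1, fun j => ?_⟩
  have h1 : permIso σ x ∈ integralSet fun j => (mhat j).1 := by
    rw [sortedDomain_eq_preimage] at hx
    exact hx.2
  obtain ⟨z, hz⟩ := exists_int_eq_of_mem_span h1 ((mem_groupG_iff g).1 hg j)
  refine ⟨z, ?_⟩
  rw [← hz, sum_permVec_mul g (mhat j).1 (fun i => permIso σ x i)]
  simp [permIso_apply]

/-- Some basis vector moved by σ⁻¹τ leaves the lattice, yet pairs integrally with every point of the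
overlap: countably many null hyperplane sections. -/
theorem hausdorff_sortedDomain_inter_eq_zero (hli : LinearIndependent ℤ fun j => (mhat j).1)
    (hsat : ∀ (a : ℤ) (v : Fin n → ℤ), a ≠ 0 →
      a • v ∈ Submodule.span ℤ (Set.range fun j => (mhat j).1) →
      v ∈ Submodule.span ℤ (Set.range fun j => (mhat j).1))
    {σ τ : Equiv.Perm (Fin n)} (h : σ⁻¹ * τ ∉ groupG mhat) :
    μHE[n - t] (sortedDomain mhat σ ∩ sortedDomain mhat τ) = 0 := by
  rw [mem_groupG_iff] at h
  push Not at h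
  obtain ⟨j, hj⟩ := h
  have hsub : sortedDomain mhat σ ∩ sortedDomain mhat τ ⊆ ⋃ z : ℤ, permIso σ ⁻¹'
      (integralSet (fun j => (mhat j).1) ∩ {x : EuclideanSpace ℝ (Fin n) |
        ∑ i, (permVec (σ⁻¹ * τ) (mhat j).1 i : ℝ) * x i = z}) := by
    rintro x ⟨hσ, hτ⟩
    obtain ⟨z, hz⟩ := hτ.2.2 j
    rw [sortedDomain_eq_preimage] at hσ
    refine Set.mem_iUnion.2 ⟨z, hσ.2, ?_⟩
    rw [Set.mem_ofPred_eq, sum_permVec_mul (σ⁻¹ * τ) (mhat j).1 (fun i => permIso σ x i), ← hz]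
    simp [permIso_apply]
  refine measure_mono_null hsub (measure_iUnion_null fun z => ?_)
  rw [hausdorff_preimage_permIso]
  exact hausdorff_integralSet_inter_hyperplane_of_notMem hli hsat hj z

theorem card_groupG_mul_hausdorff_iUnion (hli : LinearIndependent ℤ fun j => (mhat j).1)
    (hsat : ∀ (a : ℤ) (v : Fin n → ℤ), a ≠ 0 →
      a • v ∈ Submodule.span ℤ (Set.range fun j => (mhat j).1) →
      v ∈ Submodule.span ℤ (Set.range fun j => (mhat j).1)) :
    (Nat.card (groupG mhat) : ENNReal) * μHE[n - t] (⋃ σ, sortedDomain mhat σ)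
      = ∑ σ, μHE[n - t] (sortedDomain mhat σ) := by
  refine card_mul_measure_iUnion measurableSet_sortedDomain _ ?_
  have hae : ∀ᵐ x ∂(μHE[n - t] : Measure (EuclideanSpace ℝ (Fin n))),
      ∀ σ τ, σ⁻¹ * τ ∉ groupG mhat → ¬ (x ∈ sortedDomain mhat σ ∩ sortedDomain mhat τ) := by
    simp only [ae_all_iff]
    intro σ τ h
    exact measure_eq_zero_iff_ae_notMem.1 (hausdorff_sortedDomain_inter_eq_zero hli hsat h)
  refine hae.mono fun x hx hu => ?_
  obtain ⟨σ, hσ⟩ := Set.mem_iUnion.1 hu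
  -- For almost every x in the domain of σ, the permutations whose domain contains x form the coset
  -- σG.
  refine Nat.card_congr ((Equiv.mulLeft σ⁻¹).subtypeEquiv fun τ => ⟨fun hτ => ?_, fun hτ => ?_⟩)
  · by_contra hG
    exact hx σ τ hG ⟨hσ, hτ⟩
  · have h := mem_sortedDomain_mul hτ hσ
    simpa using h

/-- By `hsub` the coordinates are almost everywhere distinct, so only one permutation sorts them;
`hone` removes the faces x i = 1 that separate the closed cube from the half-open one. -/
theorem sum_hausdorff_sortedDomain (hli : LinearIndependent ℤ fun j => (mhat j).1)
    (hsat : ∀ (a : ℤ) (v : Fin n → ℤ), a ≠ 0 →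
      a • v ∈ Submodule.span ℤ (Set.range fun j => (mhat j).1) →
      v ∈ Submodule.span ℤ (Set.range fun j => (mhat j).1))
    (hone : ∀ i, Pi.single i 1 ∉ Submodule.span ℤ (Set.range fun j => (mhat j).1))
    (hsub : ∀ i j, i ≠ j →
      Pi.single i 1 - Pi.single j 1 ∉ Submodule.span ℤ (Set.range fun j => (mhat j).1)) :
    ∑ σ, μHE[n - t] (sortedDomain mhat σ)
      = μHE[n - t] (unitCube n ∩ integralSet fun j => (mhat j).1) := by
  simp only [sortedDomain_eq_preimage, hausdorff_preimage_permIso]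
  have hinj : ∀ᵐ x ∂(μHE[n - t] : Measure (EuclideanSpace ℝ (Fin n))),
      ∀ i j, i ≠ j → (x ∈ integralSet fun j => (mhat j).1) → x i ≠ x j := by
    simp only [ae_all_iff]
    intro i j hij
    refine (measure_eq_zero_iff_ae_notMem.1
      (hausdorff_integralSet_inter_hyperplane_of_notMem hli hsat (hsub i j hij) 0)).mono
      fun x hx hxm he => hx ⟨hxm, ?_⟩
    simp [sub_mul, Finset.sum_sub_distrib, Pi.single_apply, he]
  have hlt : ∀ᵐ x ∂(μHE[n - t] : Measure (EuclideanSpace ℝ (Fin n))),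
      ∀ i, (x ∈ integralSet fun j => (mhat j).1) → x i ≠ 1 := by
    simp only [ae_all_iff]
    intro i
    refine (measure_eq_zero_iff_ae_notMem.1
      (hausdorff_integralSet_inter_hyperplane_of_notMem hli hsat (hone i) 1)).mono
      fun x hx hxm he => hx ⟨hxm, ?_⟩
    simp [Pi.single_apply, he]
  rw [← card_mul_measure_iUnion (g := 1) measurableSet_permutedDomain, Nat.cast_one, one_mul]
  · refine measure_congr (hlt.mono fun x hx => propext ?_)
    constructor
    · intro h
      obtain ⟨σ, hσ⟩ := Set.mem_iUnion.1 h
      exact ⟨fun i => ⟨(hσ.1.1 i).1, lt_of_le_of_ne (hσ.1.1 i).2 (hx i hσ.2)⟩, hσ.2⟩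
    · rintro ⟨hc, hi⟩
      refine Set.mem_iUnion.2 ⟨(Tuple.sort x).symm, ⟨fun i => ⟨(hc i).1, (hc i).2.le⟩, ?_⟩, hi⟩
      exact Tuple.monotone_sort x
  · refine hinj.mono fun x hx hu => ?_
    obtain ⟨σ, hσ⟩ := Set.mem_iUnion.1 hu
    rw [Nat.card_eq_one_iff_unique]
    refine ⟨⟨fun ⟨τ, hτ⟩ ⟨ρ, hρ⟩ => Subtype.ext ?_⟩, ⟨σ, hσ⟩⟩
    have hxi : Function.Injective x := fun i j hij => by
      by_contra hne
      exact hx i j hne hσ.2 hij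
    have h := Tuple.unique_monotone hτ.1.2 hρ.1.2
    have h2 : τ.symm = ρ.symm := Equiv.ext fun i => hxi (congrFun h i)
    simpa using congrArg Equiv.symm h2

end Domains

end RootRelations

end

/-! ### Infinitely many primes split f -/

noncomputable section

open Polynomial

namespace RootRelations

/-- Euclid's argument: with c = g(0) ≠ 0, the value g(c·N!·y) is c·h with h ≡ 1 mod N!, so every
prime factor of h exceeds N. -/
theorem exists_prime_gt_dvd_eval {g : ℤ[X]} (hg : 0 < g.natDegree) (N : ℕ) :
    ∃ p : ℕ, p.Prime ∧ N < p ∧ ∃ a : ℤ, (p : ℤ) ∣ g.eval a := by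
  by_cases hc : g.eval 0 = 0
  · obtain ⟨p, hp, hpp⟩ := Nat.exists_infinite_primes (N + 1)
    exact ⟨p, hpp, hp, 0, by simp [hc]⟩
  set c := g.eval 0 with hcdef
  have hM : ((N.factorial : ℕ) : ℤ) ≠ 0 := by exact_mod_cast N.factorial_ne_zero
  have hne : g ^ 2 - C (c ^ 2) ≠ 0 := by
    intro h
    have h1 := congrArg natDegree (sub_eq_zero.1 h)
    rw [natDegree_pow, natDegree_C] at h1
    lia
  -- This choice of y keeps h away from ±1, so that h has a prime factor.
  obtain ⟨y, hy⟩ : ∃ y : ℤ, g.eval (c * N.factorial * y) ^ 2 ≠ c ^ 2 := by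
    by_contra! h
    refine hne (eq_zero_of_infinite_isRoot _ ?_)
    refine (Set.infinite_range_of_injective
      (mul_right_injective₀ (mul_ne_zero hc hM))).mono ?_
    rintro _ ⟨y, rfl⟩
    simp [IsRoot, h y]
  have hq : ∀ x, g.eval x = x * g.divX.eval x + c := fun x => by
    conv_lhs => rw [← divX_mul_X_add g]
    simp [hcdef, coeff_zero_eq_eval_zero, mul_comm]
  set h := 1 + N.factorial * y * g.divX.eval (c * N.factorial * y) with hh
  have hgh : g.eval (c * N.factorial * y) = c * h := by rw [hq, hh]; ring
  have habs : h.natAbs ≠ 1 := by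
    intro h1
    apply hy
    rw [hgh, mul_pow, ← Int.natAbs_sq h, h1]
    simp
  obtain ⟨p, hp, hpd⟩ := Nat.exists_prime_and_dvd habs
  have hpd' : (p : ℤ) ∣ h := Int.natCast_dvd.2 hpd
  refine ⟨p, hp, ?_, c * N.factorial * y, hgh ▸ hpd'.mul_left c⟩
  by_contra! hle
  have h2 : (p : ℤ) ∣ N.factorial := by exact_mod_cast hp.dvd_factorial.2 hle
  have h3 : (p : ℤ) ∣ 1 := by
    have h4 := (Int.dvd_add_left ((h2.mul_right y).mul_right
      (g.divX.eval (c * N.factorial * y)))).1 hpd'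
    exact h4
  exact hp.one_lt.ne' (by exact_mod_cast Int.eq_one_of_dvd_one (by positivity) h3)

theorem exists_integral_primitive_element {n : ℕ} {α : Fin n → ℂ} (hα : ∀ i, IsIntegral ℤ (α i)) :
    ∃ θ : ℂ, IsIntegral ℤ θ ∧ ∀ i, ∃ Q : ℚ[X], aeval θ Q = α i := by
  have hQ : ∀ i, IsIntegral ℚ (α i) := fun i => (hα i).tower_top
  let E := IntermediateField.adjoin ℚ (Set.range α)
  have : FiniteDimensional ℚ E :=
    IntermediateField.finiteDimensional_adjoin (by rintro _ ⟨i, rfl⟩; exact hQ i)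
  obtain ⟨θ₀, hθ₀⟩ := Field.exists_primitive_element ℚ E
  have halg : IsAlgebraic ℤ (θ₀ : ℂ) := by
    have h1 : IsAlgebraic ℚ (θ₀ : ℂ) :=
      (Algebra.IsAlgebraic.isAlgebraic (R := ℚ) θ₀).algebraMap (A := ℂ)
    exact (IsFractionRing.isAlgebraic_iff ℤ ℚ ℂ).2 h1
  obtain ⟨y, hy, hint⟩ := halg.exists_integral_multiple
  refine ⟨y • (θ₀ : ℂ), hint, fun i => ?_⟩
  have hi : (⟨α i, IntermediateField.subset_adjoin _ _ ⟨i, rfl⟩⟩ : E) ∈ (⊤ : IntermediateField ℚ E) :=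
    trivial
  rw [← hθ₀, ← IntermediateField.mem_toSubalgebra,
    IntermediateField.adjoin_simple_toSubalgebra_of_isAlgebraic (Algebra.IsAlgebraic.isAlgebraic θ₀),
    Algebra.adjoin_singleton_eq_range_aeval] at hi
  obtain ⟨Q, hQ⟩ := hi
  have hQ' : aeval (θ₀ : ℂ) Q = α i := by
    have h1 := congrArg (algebraMap E ℂ) hQ
    have h2 := aeval_algebraMap_apply ℂ θ₀ Q
    exact h2.trans h1
  -- The primitive element was multiplied by y to become integral; the substitution X ↦ X/y undoes
  -- this.
  refine ⟨Q.comp (C ((y : ℚ)⁻¹) * X), ?_⟩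
  have hy' : (y : ℂ) ≠ 0 := by exact_mod_cast hy
  rw [aeval_comp]
  simpa [hy'] using hQ'

/-- If `f` has the roots `α i` over `ℂ` and integral multiples `d i * α i` all come from a subring
`A` of `ℂ`, then `f` splits over every field that receives a homomorphism from `A` and in which no
`d i` vanishes. -/
theorem splits_map_of_injective_hom {n : ℕ} {f : ℤ[X]} {α : Fin n → ℂ}
    (hf : f.map (Int.castRingHom ℂ) = ∏ i, (X - C (α i))) {A F : Type*} [CommRing A] [Field F]
    {ι : A →+* ℂ} (hι : Function.Injective ι) (ψ : A →+* F) {x : Fin n → A} {d : Fin n → ℤ}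
    (hx : ∀ i, ι (x i) = d i * α i) (hd : ((∏ i, d i : ℤ) : F) ≠ 0) :
    (f.map (Int.castRingHom F)).Splits := by
  have key : ∏ i, (C (d i : A) * X - C (x i)) = C (∏ i, (d i : A)) * f.map (Int.castRingHom A) := by
    apply map_injective ι hι
    have h2 : ∀ z : ℤ, ι (z : A) = (z : ℂ) := map_intCast ι
    rw [Polynomial.map_mul, Polynomial.map_map, RingHom.ext_int (ι.comp _) (Int.castRingHom ℂ), hf,
      Polynomial.map_prod, map_C, map_prod ι, map_prod C]
    simp only [Polynomial.map_sub, Polynomial.map_mul, map_C, map_X, hx, h2]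
    rw [← Finset.prod_mul_distrib]
    refine Finset.prod_congr rfl fun i _ => ?_
    rw [C_mul, mul_sub]
  have key2 := congrArg (Polynomial.map ψ) key
  have h2 : ψ (∏ i, (d i : A)) = ((∏ i, d i : ℤ) : F) := by simp
  rw [Polynomial.map_mul, Polynomial.map_map, RingHom.ext_int (ψ.comp _) (Int.castRingHom F),
    Polynomial.map_prod, map_C, h2] at key2
  have hs : (C ((∏ i, d i : ℤ) : F) * f.map (Int.castRingHom F)).Splits := by
    rw [← key2]
    refine Splits.prod fun i _ => Splits.of_degree_le_one ?_
    rw [Polynomial.map_sub, Polynomial.map_mul, map_C, map_C, map_X, sub_eq_add_neg, ← C_neg]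
    exact degree_linear_le
  have h3 := hs.C_mul ((∏ i, d i : ℤ) : F)⁻¹
  rwa [← mul_assoc, ← C_mul, inv_mul_cancel₀ hd, C_1, one_mul] at h3

/-- A root of the minimal polynomial of θ modulo p gives a homomorphism ℤ[θ] → 𝔽_p, and integral
multiples of all `α i` lie in ℤ[θ]. Taking p above the product of the denominators keeps these
invertible. -/
theorem exists_prime_gt_splits {n : ℕ} {f : ℤ[X]} {α : Fin n → ℂ}
    (hf : f.map (Int.castRingHom ℂ) = ∏ i, (X - C (α i))) (hα : ∀ i, IsIntegral ℤ (α i)) (N : ℕ) :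
    ∃ p : ℕ, p.Prime ∧ N < p ∧ (f.map (Int.castRingHom (ZMod p))).Splits := by
  obtain ⟨θ, hθ, hQ⟩ := exists_integral_primitive_element hα
  choose Q hQ using hQ
  have hP : ∀ i, ∃ (P : ℤ[X]) (d : ℤ), d ≠ 0 ∧ aeval θ P = d * α i := fun i => by
    obtain ⟨b, hb, hbQ⟩ := IsLocalization.integerNormalization_spec (nonZeroDivisors ℤ) (Q i)
    refine ⟨IsLocalization.integerNormalization (nonZeroDivisors ℤ) (Q i), b, nonZeroDivisors.ne_zero hb, ?_⟩
    rw [← aeval_map_algebraMap ℚ, hbQ, map_zsmul, hQ, zsmul_eq_mul]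
  choose P d hd hPd using hP
  obtain ⟨p, hp, hpN, a, hpa⟩ := exists_prime_gt_dvd_eval (minpoly.natDegree_pos hθ)
    (max N (∏ i, d i).natAbs)
  refine ⟨p, hp, (le_max_left _ _).trans_lt hpN, ?_⟩
  have : Fact p.Prime := ⟨hp⟩
  have hD : ((∏ i, d i : ℤ) : ZMod p) ≠ 0 := by
    intro h0
    rw [ZMod.intCast_zmod_eq_zero_iff_dvd] at h0
    have h1 := Nat.le_of_dvd (Int.natAbs_pos.2 (Finset.prod_ne_zero_iff.2 fun i _ => hd i))
      (Int.natCast_dvd.1 h0)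
    exact absurd hpN (by simp [h1])
  let ι : AdjoinRoot (minpoly ℤ θ) →+* ℂ :=
    AdjoinRoot.lift (algebraMap ℤ ℂ) θ (by rw [← aeval_def, minpoly.aeval])
  have hι : Function.Injective ι := by
    rw [injective_iff_map_eq_zero]
    intro x hx
    obtain ⟨q, rfl⟩ := AdjoinRoot.mk_surjective x
    rw [AdjoinRoot.mk_eq_zero]
    refine minpoly.isIntegrallyClosed_dvd hθ ?_
    simpa [ι, aeval_def] using hx
  let ψ : AdjoinRoot (minpoly ℤ θ) →+* ZMod p :=
    AdjoinRoot.lift (Int.castRingHom (ZMod p)) (a : ZMod p) (by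
      rw [← eq_intCast (Int.castRingHom (ZMod p)) a, eval₂_hom, eq_intCast,
        ZMod.intCast_zmod_eq_zero_iff_dvd]
      exact hpa)
  refine splits_map_of_injective_hom hf hι ψ (x := fun i => AdjoinRoot.mk _ (P i)) (d := d)
    (fun i => ?_) hD
  rw [← hPd i]
  simp [ι, aeval_def]

end RootRelations

end

/-! ### Local roots and reduction of algebraic integers -/

noncomputable section

open Polynomial

namespace RootRelations

theorem map_univ_eq_of_prod_X_sub_C_eq {n : ℕ} {R : Type*} [CommRing R] [IsDomain R]
    {a b : Fin n → R} (h : ∏ i, (X - C (a i)) = ∏ i, (X - C (b i))) :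
    Finset.univ.val.map a = Finset.univ.val.map b := by
  have key : ∀ c : Fin n → R, (∏ i, (X - C (c i))).roots = Finset.univ.val.map c := fun c => by
    rw [← roots_multiset_prod_X_sub_C (Finset.univ.val.map c), Multiset.map_map]
    rfl
  rw [← key a, ← key b, h]

theorem eq_of_monotone_of_map_univ_eq {n : ℕ} {β : Type*} [PartialOrder β] {a b : Fin n → β}
    (ha : Monotone a) (hb : Monotone b) (h : Finset.univ.val.map a = Finset.univ.val.map b) :
    a = b := by
  rw [Fin.univ_val_map, Fin.univ_val_map, Multiset.coe_eq_coe] at h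
  exact List.ofFn_injective
    (h.eq_of_pairwise' ha.sortedLE_ofFn.pairwise hb.sortedLE_ofFn.pairwise)

theorem map_univ_comp_perm {n : ℕ} {β : Type*} (a : Fin n → β) (σ : Equiv.Perm (Fin n)) :
    Finset.univ.val.map (a ∘ σ) = Finset.univ.val.map a := by
  rw [← Multiset.map_map, Multiset.map_univ_val_equiv]

theorem exists_perm_of_map_univ_eq {n : ℕ} {β : Type*} {a b : Fin n → β}
    (h : Finset.univ.val.map a = Finset.univ.val.map b) :
    ∃ ρ : Equiv.Perm (Fin n), ∀ i, a i = b (ρ i) := by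
  classical
  -- An arbitrary linear order, used only to sort both families.
  let : LinearOrder β := IsWellOrder.linearOrder WellOrderingRel
  have h1 : a ∘ Tuple.sort a = b ∘ Tuple.sort b :=
    eq_of_monotone_of_map_univ_eq (Tuple.monotone_sort a) (Tuple.monotone_sort b) (by
      rw [map_univ_comp_perm, map_univ_comp_perm, h])
  exact ⟨(Tuple.sort a).symm.trans (Tuple.sort b), fun i => by
    simpa using congrFun h1 ((Tuple.sort a).symm i)⟩

theorem exists_isLocalRoots {n : ℕ} {f : ℤ[X]} (hf : f.Monic) (hn : f.natDegree = n) {p : ℕ}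
    (hp : p.Prime) (hs : (f.map (Int.castRingHom (ZMod p))).Splits) :
    ∃ r : Fin n → ℤ, IsLocalRoots f p r := by
  have : Fact p.Prime := ⟨hp⟩
  have hfm := hf.map (Int.castRingHom (ZMod p))
  obtain ⟨l, hl⟩ := Quot.exists_rep (f.map (Int.castRingHom (ZMod p))).roots
  have hl' : (l : Multiset (ZMod p)) = (f.map (Int.castRingHom (ZMod p))).roots := hl
  have hlen : l.length = n := by
    rw [← Multiset.coe_card, hl', ← hs.natDegree_eq_card_roots, hf.natDegree_map, hn]
  subst hlen
  have hprod : f.map (Int.castRingHom (ZMod p)) = ∏ i, (X - C (l.get i)) := by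
    have h1 : Finset.univ.val.map l.get = (l : Multiset (ZMod p)) := by
      rw [Fin.univ_val_map, List.ofFn_get]
    rw [hs.eq_prod_roots_of_monic hfm, ← hl', ← h1, Multiset.map_map]
    rfl
  let r₀ : Fin l.length → ℤ := fun i => ((l.get i).val : ℤ)
  refine ⟨r₀ ∘ Tuple.sort r₀, ?_, fun i => ⟨Int.natCast_nonneg _, ?_⟩, fun i j h => Tuple.monotone_sort r₀ h⟩
  · rw [hprod, ← Equiv.prod_comp (Tuple.sort r₀)]
    simp [r₀]
  · simp only [r₀, Function.comp_apply]
    exact_mod_cast ZMod.val_lt _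

theorem IsLocalRoots.unique {n : ℕ} {f : ℤ[X]} {p : ℕ} (hp : p.Prime) {r s : Fin n → ℤ}
    (hr : IsLocalRoots f p r) (hs : IsLocalRoots f p s) : r = s := by
  have : Fact p.Prime := ⟨hp⟩
  have hval : ∀ u : Fin n → ℤ, (∀ i, 0 ≤ u i ∧ u i < p) → Finset.univ.val.map u
      = (Finset.univ.val.map fun i => (u i : ZMod p)).map fun x => (x.val : ℤ) := fun u hu => by
    rw [Multiset.map_map]
    refine Multiset.map_congr rfl fun i _ => ?_
    rw [Function.comp_apply, ZMod.val_intCast, Int.emod_eq_of_lt (hu i).1 (hu i).2]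
  refine eq_of_monotone_of_map_univ_eq (fun i j h => hr.2.2 i j h) (fun i j h => hs.2.2 i j h) ?_
  rw [hval r hr.2.1, hval s hs.2.1,
    map_univ_eq_of_prod_X_sub_C_eq (hr.1.symm.trans hs.1)]

/-- A homomorphism from the ring of algebraic integers to a field of characteristic `p`. -/
theorem exists_ringHom_integralClosure (p : ℕ) (hp : p.Prime) :
    ∃ (F : Type) (_ : Field F) (_ : CharP F p), Nonempty (integralClosure ℤ ℂ →+* F) := by
  have hprime : Prime (p : ℤ) := Nat.prime_iff_prime_int.1 hp
  have hmax : (Ideal.span {(p : ℤ)}).IsMaximal :=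
    PrincipalIdealRing.isMaximal_of_irreducible hprime.irreducible
  obtain ⟨P, hP, hPo⟩ := Ideal.exists_maximal_ideal_liesOver_of_isIntegral
    (S := integralClosure ℤ ℂ) (Ideal.span {(p : ℤ)})
  let := Ideal.Quotient.field P
  refine ⟨integralClosure ℤ ℂ ⧸ P, inferInstance, ⟨fun x => ?_⟩, ⟨Ideal.Quotient.mk P⟩⟩
  have h1 : ((x : ℤ) ∈ Ideal.span {(p : ℤ)}) ↔
      algebraMap ℤ (integralClosure ℤ ℂ) x ∈ P := Ideal.mem_of_liesOver P _ _
  rw [Ideal.mem_span_singleton, Int.natCast_dvd_natCast] at h1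
  rw [h1, ← Ideal.Quotient.eq_zero_iff_mem]
  simp

/-- By integrality the ideal (β) meets ℤ nontrivially. Hence reduction at p can kill β for only
finitely many p. -/
theorem exists_ne_zero_int_dvd (β : integralClosure ℤ ℂ) (hβ : β ≠ 0) :
    ∃ N : ℤ, N ≠ 0 ∧ β ∣ (N : integralClosure ℤ ℂ) := by
  have h := Ideal.comap_ne_bot_of_integral_mem (R := ℤ) hβ (Ideal.mem_span_singleton_self β)
    (Algebra.IsIntegral.isIntegral β)
  obtain ⟨N, hN, hN0⟩ := Submodule.exists_mem_ne_zero_of_ne_bot h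
  exact ⟨N, hN0, by simpa [Ideal.mem_span_singleton] using hN⟩

end RootRelations

end

/-! ### Counting permutations and summing densities -/

noncomputable section

open Polynomial Filter

namespace RootRelations

/-- For all large `p`, the number of permutations for which the local roots modulo `p` satisfy the
linear relations is the order of the symmetry group of the relations. -/
theorem card_perm_congruence_eq {n t : ℕ} {f : ℤ[X]} {α : Fin n → ℂ}
    {mhat : Fin t → (Fin n → ℤ) × ℤ} (hf : f.map (Int.castRingHom ℂ) = ∏ i, (X - C (α i)))
    (hα : ∀ i, IsIntegral ℤ (α i)) (hm : IsRelBasis α mhat) :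
    ∃ N₀ : ℕ, ∀ p : ℕ, p.Prime → N₀ < p → ∀ r : Fin n → ℤ, IsLocalRoots f p r →
      Nat.card {σ : Equiv.Perm (Fin n) //
        ∀ j, ∑ i, (mhat j).1 i * r (σ i) ≡ (mhat j).2 [ZMOD (p : ℤ)]}
      = Nat.card (groupGhat mhat) := by
  let a : Fin n → integralClosure ℤ ℂ := fun i => ⟨α i, hα i⟩
  -- The defect of the j-th relation after permuting the roots by τ. For large p it vanishes after
  -- reduction only if it is already zero.
  let β : Equiv.Perm (Fin n) → Fin t → integralClosure ℤ ℂ := fun τ j =>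
    ∑ i, ((mhat j).1 i : integralClosure ℤ ℂ) * a (τ i) - ((mhat j).2 : integralClosure ℤ ℂ)
  have hβ : ∀ τ j, β τ j = 0 ↔ ∑ i, ((mhat j).1 i : ℂ) * α (τ i) = (mhat j).2 := fun τ j => by
    rw [sub_eq_zero, Subtype.ext_iff]
    simp [a]
  have hN : ∀ τ j, ∃ N : ℤ, N ≠ 0 ∧ (β τ j ≠ 0 → β τ j ∣ (N : integralClosure ℤ ℂ)) := by
    intro τ j
    by_cases h : β τ j = 0
    · exact ⟨1, one_ne_zero, fun h' => absurd h h'⟩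
    · obtain ⟨N, hN, hd⟩ := exists_ne_zero_int_dvd _ h
      exact ⟨N, hN, fun _ => hd⟩
  choose N hN0 hNd using hN
  refine ⟨(∏ τ, ∏ j, N τ j).natAbs, fun p hp hlt r hr => ?_⟩
  have hpN : ∀ τ j, ¬ (p : ℤ) ∣ N τ j := fun τ j hd => by
    have h1 : (p : ℤ) ∣ ∏ τ, ∏ j, N τ j :=
      (hd.trans (Finset.dvd_prod_of_mem (N τ) (Finset.mem_univ j))).trans
        (Finset.dvd_prod_of_mem (fun τ => ∏ j, N τ j) (Finset.mem_univ τ))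
    have h2 := Nat.le_of_dvd (Int.natAbs_pos.2 (Finset.prod_ne_zero_iff.2 fun τ _ =>
      Finset.prod_ne_zero_iff.2 fun j _ => hN0 τ j)) (Int.natCast_dvd.1 h1)
    exact absurd h2 (not_le.2 hlt)
  obtain ⟨F, _, _, ⟨φ⟩⟩ := exists_ringHom_integralClosure p hp
  have hφ : ∀ τ j, φ (β τ j) = 0 ↔ β τ j = 0 := fun τ j => by
    refine ⟨fun h => ?_, fun h => by rw [h, map_zero]⟩
    by_contra h0
    have h1 := map_dvd φ (hNd τ j h0)
    rw [h, zero_dvd_iff, map_intCast, CharP.intCast_eq_zero_iff F p] at h1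
    exact hpN τ j h1
  obtain ⟨ρ, hρ⟩ : ∃ ρ : Equiv.Perm (Fin n), ∀ i, φ (a i) = ((r (ρ i) : ℤ) : F) := by
    refine exists_perm_of_map_univ_eq (b := fun i => ((r i : ℤ) : F))
      (map_univ_eq_of_prod_X_sub_C_eq ?_)
    have h1 : f.map (Int.castRingHom (integralClosure ℤ ℂ)) = ∏ i, (X - C (a i)) := by
      apply map_injective (algebraMap (integralClosure ℤ ℂ) ℂ) Subtype.val_injective
      rw [Polynomial.map_map, RingHom.ext_int (RingHom.comp _ _) (Int.castRingHom ℂ), hf,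
        Polynomial.map_prod]
      refine Finset.prod_congr rfl fun i _ => ?_
      rw [Polynomial.map_sub, map_X, map_C]
      rfl
    have h2 := congrArg (Polynomial.map φ) h1
    have h3 := congrArg (Polynomial.map (ZMod.castHom (dvd_refl p) F)) hr.1
    rw [Polynomial.map_map, RingHom.ext_int (RingHom.comp _ _) (Int.castRingHom F),
      Polynomial.map_prod] at h2 h3
    rw [h2] at h3
    have h4 : ∀ z : ℤ, ZMod.castHom (dvd_refl p) F (z : ZMod p) = (z : F) := map_intCast _
    simpa only [Polynomial.map_sub, map_X, map_C, h4] using h3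
  -- Since φ(a i) = r (ρ i), the congruences for σ are the exact relations for ρ⁻¹σ.
  refine Nat.card_congr ((Equiv.mulLeft ρ⁻¹).subtypeEquiv fun σ => ?_)
  change _ ↔ ρ⁻¹ * σ ∈ groupGhat mhat
  rw [mem_groupGhat_iff hm]
  refine forall_congr' fun j => ?_
  rw [← hβ, ← hφ, Int.modEq_comm, Int.modEq_iff_dvd, ← CharP.intCast_eq_zero_iff F p]
  simp [β, hρ]

/-- Counting a finite family of sets of natural numbers inside an infinite set that all but finitely
many points of it meet exactly `g` times gives total density `g`. -/
theorem sum_density_eq {κ : Type*} [Fintype κ] {P : ℕ → Prop} {Q : κ → ℕ → Prop}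
    (hP : ∀ N, ∃ p, N < p ∧ P p) {g N₀ : ℕ}
    (hg : ∀ p, N₀ < p → P p → Nat.card {σ // Q σ p} = g) {d : κ → ℝ}
    (hd : ∀ σ, Tendsto (fun x : ℕ => ({p | (P p ∧ p ≤ x) ∧ Q σ p}.ncard : ℝ) /
      ({p | P p ∧ p ≤ x}.ncard : ℝ)) atTop (nhds (d σ))) :
    ∑ σ, d σ = g := by
  classical
  let S : ℕ → Finset ℕ := fun x => (Finset.range (x + 1)).filter P
  have hS : ∀ x, {p | P p ∧ p ≤ x}.ncard = (S x).card := fun x => by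
    rw [← Set.ncard_coe_finset]
    congr 1
    ext p
    simp [S, and_comm]
  have hQ : ∀ σ x, {p | (P p ∧ p ≤ x) ∧ Q σ p}.ncard = ((S x).filter (Q σ)).card := fun σ x => by
    rw [← Set.ncard_coe_finset]
    congr 1
    ext p
    simp [S, and_comm]
  simp only [hS, hQ] at hd
  have hinf : Tendsto (fun x => ((S x).card : ℝ)) atTop atTop := by
    refine tendsto_natCast_atTop_atTop.comp (tendsto_atTop_atTop_of_monotone ?_ ?_)
    · intro x y hxy
      exact Finset.card_le_card (Finset.filter_subset_filter _
        (Finset.range_subset_range.2 (by lia)))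
    · intro k
      induction k with
      | zero => exact ⟨0, Nat.zero_le _⟩
      | succ k ih =>
        obtain ⟨x, hx⟩ := ih
        obtain ⟨p, hp, hPp⟩ := hP x
        refine ⟨p, Nat.lt_of_le_of_lt hx (Finset.card_lt_card ⟨?_, fun h => ?_⟩)⟩
        · exact Finset.filter_subset_filter _ (Finset.range_subset_range.2 (by lia))
        · have h1 : p ∈ S x := h (by simp [S, hPp])
          simp only [S, Finset.mem_filter, Finset.mem_range] at h1
          lia
  let c : ℕ → ℝ := fun p => (Nat.card {σ // Q σ p} : ℝ)
  have hsum : ∀ x, ∑ σ, (((S x).filter (Q σ)).card : ℝ) = ∑ p ∈ S x, c p := fun x => by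
    simp only [c, Nat.card_eq_fintype_card, Fintype.card_subtype, Finset.card_filter,
      Nat.cast_sum]
    rw [Finset.sum_comm]
  -- Points beyond N₀ contribute exactly g each, so the error is a constant, negligible after
  -- division by the unbounded `(S x).card`.
  have hK : ∀ x, N₀ ≤ x →
      ∑ p ∈ S x, c p = g * (S x).card + ∑ p ∈ S N₀, (c p - g) := fun x hx => by
    have h1 : ∑ p ∈ S N₀, (c p - g) = ∑ p ∈ S x, (c p - g) := by
      refine Finset.sum_subset (Finset.filter_subset_filter _
        (Finset.range_subset_range.2 (by lia))) fun p hp hp' => ?_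
      simp only [S, Finset.mem_filter, Finset.mem_range] at hp hp'
      have h2 : N₀ < p := by
        by_contra! h
        exact hp' ⟨by lia, hp.2⟩
      simp only [c, hg p h2 hp.2, sub_self]
    rw [h1, Finset.sum_sub_distrib]
    simp [mul_comm]
  have hlim : Tendsto (fun x => ∑ σ, (((S x).filter (Q σ)).card : ℝ) / ((S x).card : ℝ)) atTop
      (nhds (∑ σ, d σ)) := tendsto_finsetSum _ fun σ _ => hd σ
  have hlim2 : Tendsto (fun x => (g : ℝ) + (∑ p ∈ S N₀, (c p - g)) / ((S x).card : ℝ)) atTop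
      (nhds ((g : ℝ) + 0)) := tendsto_const_nhds.add (hinf.const_div_atTop _)
  rw [add_zero] at hlim2
  refine tendsto_nhds_unique hlim (hlim2.congr' ?_)
  filter_upwards [eventually_ge_atTop N₀, hinf.eventually_gt_atTop 0] with x hx hx0
  rw [← Finset.sum_div, hsum, hK x hx, add_div, mul_div_assoc, div_self hx0.ne', mul_one]

end RootRelations

end

/-! ### Assembly of the proposition -/

noncomputable section

open Polynomial Filter

namespace RootRelations

theorem sum_density_eq_card_groupGhat {n t : ℕ} {f : ℤ[X]} (hmon : f.Monic) {α : Fin n → ℂ}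
    {mhat : Fin t → (Fin n → ℤ) × ℤ} (hf : f.map (Int.castRingHom ℂ) = ∏ i, (X - C (α i)))
    (hα : ∀ i, IsIntegral ℤ (α i)) (hm : IsRelBasis α mhat) {Pr : Equiv.Perm (Fin n) → ℝ}
    (hPr : ∀ σ, HasDensity f mhat σ (Pr σ)) :
    ∑ σ, Pr σ = Nat.card (groupGhat mhat) := by
  have hdeg : f.natDegree = n := by
    rw [← hmon.natDegree_map (Int.castRingHom ℂ), hf, natDegree_prod_of_monic _ _
      fun i _ => monic_X_sub_C _]
    simp
  obtain ⟨N₀, hN₀⟩ := card_perm_congruence_eq hf hα hm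
  refine sum_density_eq (P := fun p => p.Prime ∧ (f.map (Int.castRingHom (ZMod p))).Splits)
    (Q := fun σ p => ∃ r : Fin n → ℤ, IsLocalRoots f p r ∧
      ∀ j, ∑ i, (mhat j).1 i * r (σ i) ≡ (mhat j).2 [ZMOD (p : ℤ)]) (N₀ := N₀)
    (fun N => ?_) (fun p hp hP => ?_) fun σ => ?_
  · obtain ⟨p, hp, hN, hs⟩ := exists_prime_gt_splits hf hα N
    exact ⟨p, hN, hp, hs⟩
  · obtain ⟨r, hr⟩ := exists_isLocalRoots hmon hdeg hP.1 hP.2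
    rw [← hN₀ p hP.1 hp r hr]
    refine Nat.card_congr (Equiv.subtypeEquivRight fun σ => ⟨?_, fun h => ⟨r, hr, h⟩⟩)
    rintro ⟨s, hs, h⟩
    rwa [hs.unique hP.1 hr] at h
  · have h1 : ∀ x, Spl f x
        = {p | (p.Prime ∧ (f.map (Int.castRingHom (ZMod p))).Splits) ∧ p ≤ x} := fun x => by
      ext p
      simp only [Spl, Set.mem_ofPred_eq]
      tauto
    have h2 := hPr σ
    simp only [HasDensity, SplPerm, h1] at h2
    exact h2

theorem single_mem_LR₀_iff {n : ℕ} {α : Fin n → ℂ} (i : Fin n) :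
    (fun k => ((Pi.single i 1 : Fin n → ℤ) k : ℚ)) ∈ LR₀ α ↔ ∃ q : ℚ, α i = q := by
  change (∃ q : ℚ, ∑ k, ((((Pi.single i 1 : Fin n → ℤ) k : ℤ) : ℚ) : ℂ) * α k = q) ↔ _
  simp [Pi.single_apply, apply_ite (Int.cast : ℤ → ℚ), apply_ite (Rat.cast : ℚ → ℂ)]

theorem single_sub_single_mem_LR₀_iff {n : ℕ} {α : Fin n → ℂ} (i j : Fin n) :
    (fun k => ((Pi.single i 1 - Pi.single j 1 : Fin n → ℤ) k : ℚ)) ∈ LR₀ α ↔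
      ∃ q : ℚ, α i - α j = q := by
  change (∃ q : ℚ, ∑ k, ((((Pi.single i 1 - Pi.single j 1 : Fin n → ℤ) k : ℤ) : ℚ) : ℂ) * α k
    = q) ↔ _
  simp [Pi.single_apply, apply_ite (Int.cast : ℤ → ℚ), apply_ite (Rat.cast : ℚ → ℂ), sub_mul, Finset.sum_sub_distrib]

end RootRelations

end

theorem proposition5p2 (n : ℕ) (f : Polynomial ℤ) (hf : f.Monic) (α : Fin n → ℂ)
    (hα : f.map (Int.castRingHom ℂ) = ∏ i, (Polynomial.X - Polynomial.C (α i)))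
    (mhat : Fin (RootRelations.relDim α) → (Fin n → ℤ) × ℤ)
    (hm : RootRelations.IsRelBasis α mhat)
    (hlin : ¬ (f.map (Int.castRingHom ℚ)).Splits)
    (hdiff : ∀ i j, i ≠ j → ∀ q : ℚ, α i - α j ≠ (q : ℂ)) :
    (Nat.card (RootRelations.groupG mhat) : ENNReal) *
        RootRelations.vol α (⋃ σ, RootRelations.sortedDomain mhat σ)
      = ∑ σ, RootRelations.vol α (RootRelations.sortedDomain mhat σ) ∧
    RootRelations.vol α (RootRelations.unitCube n ∩ RootRelations.fullDomain α)
      = ENNReal.ofReal (RootRelations.sqrtGram mhat) ∧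
    ((∀ q : ℚ, Polynomial.aeval q f ≠ 0) →
      ∑ σ, RootRelations.vol α (RootRelations.sortedDomain mhat σ)
          = RootRelations.vol α (RootRelations.unitCube n ∩ RootRelations.fullDomain α) ∧
      ∀ (c : ℝ) (Pr : Equiv.Perm (Fin n) → ℝ),
        (∀ σ, RootRelations.HasDensity f mhat σ (Pr σ)) →
        (∀ σ, (RootRelations.vol α (RootRelations.sortedDomain mhat σ)).toReal = c * Pr σ) →
        c = RootRelations.sqrtGram mhat / (Nat.card (RootRelations.groupGhat mhat) : ℝ)) := by
  open RootRelations in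
  have hroot : ∀ i, Polynomial.eval₂ (Int.castRingHom ℂ) (α i) f = 0 := fun i => by
    rw [← Polynomial.eval_map, hα, Polynomial.eval_prod]
    exact Finset.prod_eq_zero (Finset.mem_univ i) (by simp)
  have hint : ∀ i, IsIntegral ℤ (α i) := fun i => ⟨f, hf, hroot i⟩
  have hli := linearIndependent_fst hm
  have hsat := mem_span_fst_of_smul_mem hm hint
  have hvol : vol α (unitCube n ∩ fullDomain α) = ENNReal.ofReal (sqrtGram mhat) := by
    rw [fullDomain_eq hm hint, Set.inter_comm]
    exact hausdorff_integralSet_inter_unitCube_of_saturated hli hsat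
  refine ⟨card_groupG_mul_hausdorff_iUnion hli hsat, hvol, fun hrat => ?_⟩
  have hsum : ∑ σ, vol α (sortedDomain mhat σ) = vol α (unitCube n ∩ fullDomain α) := by
    rw [fullDomain_eq hm hint]
    refine sum_hausdorff_sortedDomain hli hsat (fun i => ?_) fun i j hij => ?_
    · rw [mem_span_fst_iff hm hint, single_mem_LR₀_iff]
      rintro ⟨q, hq⟩
      refine hrat q ?_
      have h1 := hroot i
      rw [hq] at h1
      have h2 := Polynomial.aeval_algebraMap_apply ℂ q f
      rw [eq_ratCast, Polynomial.aeval_def, RingHom.ext_int (algebraMap ℤ ℂ) (Int.castRingHom ℂ),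
        h1, eq_ratCast] at h2
      exact_mod_cast h2.symm
    · rw [mem_span_fst_iff hm hint, single_sub_single_mem_LR₀_iff]
      rintro ⟨q, hq⟩
      exact hdiff i j hij q hq
  refine ⟨hsum, fun c Pr hPr hc => ?_⟩
  -- The total volume is finite, so the identity passes to real numbers and reads c · #Ĝ = `sqrtGram
  -- mhat`.
  have hfin : ∀ σ ∈ Finset.univ, vol α (sortedDomain mhat σ) ≠ ⊤ :=
    ENNReal.sum_ne_top.1 (by rw [hsum, hvol]; exact ENNReal.ofReal_ne_top)
  have hreal := congrArg ENNReal.toReal (hsum.trans hvol)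
  rw [ENNReal.toReal_sum hfin, ENNReal.toReal_ofReal (show 0 ≤ sqrtGram mhat from Real.sqrt_nonneg _),
    Finset.sum_congr rfl fun σ _ => hc σ, ← Finset.mul_sum,
    sum_density_eq_card_groupGhat hf hα hint hm hPr] at hreal
  have hone : (1 : Equiv.Perm (Fin n)) ∈ groupGhat mhat :=
    (mem_groupGhat_iff hm 1).2 fun j => by
      have h := Submodule.subset_span (R := ℤ) (Set.mem_range_self (f := mhat) j)
      rw [hm.span_eq] at h
      exact (mem_intLR_iff _).1 h
  have : Nonempty (groupGhat mhat) := ⟨⟨1, hone⟩⟩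
  have hpos : (Nat.card (groupGhat mhat) : ℝ) ≠ 0 := by
    exact_mod_cast Nat.card_pos.ne'
  rw [eq_div_iff hpos, hreal]
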